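/- Let $L_1,L_2\ge 1$ be integers, and for $n,m\in\mathbb Z$ let $C(n,m)=\{t\in\mathbb Z^2: nL_1\le t_1<(n+1)L_1,\ mL_2\le t_2<(m+1)L_2\}$. Let $\mathbf Z_+$ be the union of the cells $C(n,m)$ with $n+m$ even. For $J>0$ and $h>0$ let $h(s)=h$ if $s\in\mathbf Z_+$ and $h(s)=-h$ otherwise. For an even integer $N\ge 2$ let $\mathbb T_N=\mathbb Z^2/(NL_1\mathbb Z\times NL_2\mathbb Z)$, on which the field $h(\cdot)$ is well defined, and let $\mu_{\beta,N}$ be the Gibbs measure on $\{-1,+1\}^{\mathbb T_N}$, $$\mu_{\beta,N}(\sigma)=\frac1{Z_N(\beta)}\exp\Bigl(\beta J\sum_{\langle t,s\rangle}\sigma(t)\sigma(s)+\beta\sum_{s\in\mathbb T_N}h(s)\sigma(s)\Bigr),$$ where $Z_N(\beta)$ is the normalizing constant and the first sum runs over the nearest-neighbour bonds of the torus, that is, the images of the bonds of $\mathbb Z^2$ (if $NL_i=2$, two bonds join neighbours in direction $i$, and both are counted). Let $B_i=L_i$ if $L_i$ is even and $B_i=L_i+1$ if $L_i$ is odd. There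 is a universal (combinatorial) constant $c>1$, independent of $L_1,L_2,J,h,\beta,N$ and of the sites, such that the following holds. If $$h<\frac{2J}{L_1}+\frac{2J}{L_2}$$ and $$\beta>\beta'=\frac{4\bigl[(B_1B_2+2)\ln 2+2\ln(c(c+1))\bigr]}{2J-\frac{hL_1L_2}{L_1+L_2}},$$ then for every even $N\ge2$ and all $s,t\in\mathbb T_N$ $$\mu_{\beta,N}\bigl(\sigma(s)=+1,\ \sigma(t)=-1\bigr)\le 2c(c+1)\,2^{B_1B_2/2}\exp\Bigl\{-\frac{\beta}{8}\Bigl(2J-\frac{hL_1L_2}{L_1+L_2}\Bigr)\Bigr\}.$$ -/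

import Mathlib

noncomputable section

namespace CellBoard

/-- The cell `C(n, m)` of `L₁ × L₂` sites of `ℤ²`. -/
def cell (L₁ L₂ : ℕ) (n m : ℤ) : Set (ℤ × ℤ) :=
  {t | n * L₁ ≤ t.1 ∧ t.1 < (n + 1) * L₁ ∧ m * L₂ ≤ t.2 ∧ t.2 < (m + 1) * L₂}

/-- The white sites of `ℤ²`: the union of the cells `C(n, m)` with `n + m` even. -/
def zPlus (L₁ L₂ : ℕ) : Set (ℤ × ℤ) :=
  {t | ∃ n m : ℤ, Even (n + m) ∧ t ∈ cell L₁ L₂ n m}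

open Classical in
/-- The cell-board external field on `ℤ²`: `h` on white sites and `-h` on the others. -/
def field (L₁ L₂ : ℕ) (h : ℝ) (t : ℤ × ℤ) : ℝ :=
  if t ∈ zPlus L₁ L₂ then h else -h

/-- The discrete torus `ℤ² / (N L₁ ℤ × N L₂ ℤ)`. -/
abbrev Torus (N L₁ L₂ : ℕ) : Type := ZMod (N * L₁) × ZMod (N * L₂)

/-- Configurations on the torus; the spin values are `1` and `-1`, the units of `ℤ`. -/
abbrev Config (N L₁ L₂ : ℕ) : Type := Torus N L₁ L₂ → ℤˣ

/-- The spin at `t`, as a real number. -/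
def spin {N L₁ L₂ : ℕ} (σ : Config N L₁ L₂) (t : Torus N L₁ L₂) : ℝ :=
  ((σ t : ℤ) : ℝ)

/-- The external field on the torus, read off at the representative in
`[0, N L₁) × [0, N L₂)`. For even `N` the field on `ℤ²` is periodic with periods `N L₁` and
`N L₂`, so that the choice of the representative does not matter. -/
def torusField (N L₁ L₂ : ℕ) (h : ℝ) (s : Torus N L₁ L₂) : ℝ :=
  field L₁ L₂ h ((s.1.val : ℤ), (s.2.val : ℤ))

variable (N L₁ L₂ : ℕ) [NeZero N] [NeZero L₁] [NeZero L₂]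

/-- The Hamiltonian with periodic boundary conditions. The bonds of the torus are the images of
the bonds of `ℤ²`: from each site `t` one bond goes to `t + (1, 0)` and one to `t + (0, 1)`, and
each bond is listed once in this way. -/
def hamiltonian (J h : ℝ) (σ : Config N L₁ L₂) : ℝ :=
  -J * ∑ t : Torus N L₁ L₂,
      (spin σ t * spin σ (t + (1, 0)) + spin σ t * spin σ (t + (0, 1)))
    - ∑ s : Torus N L₁ L₂, torusField N L₁ L₂ h s * spin σ s

/-- The partition function. -/
def partitionFunction (J h β : ℝ) : ℝ :=
  ∑ σ : Config N L₁ L₂, Real.exp (-β * hamiltonian N L₁ L₂ J h σ)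

/-- The Gibbs probability of a single configuration. -/
def gibbsMass (J h β : ℝ) (σ : Config N L₁ L₂) : ℝ :=
  Real.exp (-β * hamiltonian N L₁ L₂ J h σ) / partitionFunction N L₁ L₂ J h β

/-- The Gibbs measure of an event. -/
def gibbsProb (J h β : ℝ) (A : Set (Config N L₁ L₂)) : ℝ :=
  ∑ σ : Config N L₁ L₂, A.indicator (gibbsMass N L₁ L₂ J h β) σ

/-- The side of a block: `L` if `L` is even and `L + 1` if `L` is odd. -/
def blockSide (L : ℕ) : ℕ := if Even L then L else L + 1

/-- The Peierls constant `2J - h L₁ L₂ / (L₁ + L₂)`. -/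
def peierlsConst (L₁ L₂ : ℕ) (J h : ℝ) : ℝ :=
  2 * J - h * L₁ * L₂ / (L₁ + L₂)

/-- The threshold `β'` for the inverse temperature. -/
def betaThreshold (L₁ L₂ : ℕ) (J h c : ℝ) : ℝ :=
  4 * (((blockSide L₁ : ℝ) * (blockSide L₂ : ℝ) + 2) * Real.log 2
      + 2 * Real.log (c * (c + 1))) / peierlsConst L₁ L₂ J h

end CellBoard

end

noncomputable section

namespace CellBoard

/-! Opposite spins at two sites force a contour of non-constant ("mixed") blocks between them, and
reflection positivity makes such contours exponentially unlikely.

An extra spin is put at the midpoint of every bond, with a coupling `κ` for which summing it out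
restores `β * J` (`exists_decoration_coupling`, `gibbsProb_eq`). No coupling then jumps across a
line through the centres of a row or column of cells, whether the line runs through sites or through
bond midpoints. The field is symmetric about these lines, so Cauchy–Schwarz, conditionally on the
spins of the mirror, gives the reflection inequality `mixedWeight_sq_le`. The lines cut the torus
into `N ^ 2` closed blocks. The chessboard estimate `decoWeight_le_pow` bounds the relative weight
of "every block of `B` is mixed" by `ε ^ B.card`, once this is known for the set of all blocks.

That case is a Peierls estimate. The field is the divergence of a flow of size at most `L₁ / 2` in
the first direction, and also of one of size at most `L₂ / 2` in the second. Hence its energy is at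
most `h * L₁ * L₂ / (L₁ + L₂)` per frustrated half-bond (`abs_sum_sign_le`), and each of these keeps
a net cost `β * P`, with `P` the Peierls constant. If all blocks are mixed, at least `N ^ 2 / 4`
half-bonds are frustrated. Half of their cost pays for the entropy, the other half leaves `ε = 6 *
exp (-β P / 8)` (`decoWeight_univ_le`).

Neighbouring unmixed blocks overlap, hence carry the same sign. If the blocks of the two sites
differ in state, `exists_separating_cluster` gives a cluster of mixed blocks that either has at
least `N` blocks, or has at least `r` blocks with one of them `r` steps to the right of one of the
two given blocks. It rests on `ℤ/2` cohomology: on the torus, the boundary carried by a cluster of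
fewer than `N` blocks is a coboundary. Counting clusters by closed king walks and summing over their
sizes gives a constant times `ε` (`weightOf_separated_le`). -/

/-! ### Folding a cyclic sequence about a pair of antipodal bonds -/

/-- The half of the cycle `ℤ/N` that starts at `k` and has `N / 2` elements. -/
def HalfCycle {N : ℕ} (k i : ZMod N) : Prop := (i - k).val < N / 2

open Classical in
/-- The sequence that agrees with `τ` on the half cycle at `k`, and is symmetric under
`i ↦ 2 k - 1 - i`. -/
def foldIn {N : ℕ} {α : Type*} (k : ZMod N) (τ : ZMod N → α) (i : ZMod N) : α :=
  if HalfCycle k i then τ i else τ (2 * k - 1 - i)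

open Classical in
/-- The sequence that agrees with `τ` off the half cycle at `k`, and is symmetric under
`i ↦ 2 k - 1 - i`. -/
def foldOut {N : ℕ} {α : Type*} (k : ZMod N) (τ : ZMod N → α) (i : ZMod N) : α :=
  if HalfCycle k i then τ (2 * k - 1 - i) else τ i

theorem val_neg_one_sub {N : ℕ} [NeZero N] (j : ZMod N) : (-1 - j).val = N - 1 - j.val := by
  have hj := ZMod.val_lt j
  have : (-1 - j) = ((N - 1 - j.val : ℕ) : ZMod N) := by
    rw [Nat.cast_sub (by omega), Nat.cast_sub (by omega)]
    simp
  rw [this, ZMod.val_cast_of_lt (by omega)]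

theorem halfCycle_reflect {N : ℕ} [NeZero N] (hN : Even N) (k i : ZMod N) :
    HalfCycle k (2 * k - 1 - i) ↔ ¬ HalfCycle k i := by
  unfold HalfCycle
  have h1 : 2 * k - 1 - i - k = -1 - (i - k) := by ring
  rw [h1, val_neg_one_sub]
  have := ZMod.val_lt (i - k)
  obtain ⟨M, rfl⟩ := hN
  omega

/-- Only two bonds join the two halves, the one ending at `k` and its antipode, and the reflection
maps each to itself. Evenness of `N` enters at the antipode. -/
theorem reflect_eq_add_one {N : ℕ} [NeZero N] (hN : Even N) (k i : ZMod N)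
    (h : ¬ (HalfCycle k i ↔ HalfCycle k (i + 1))) : 2 * k - 1 - i = i + 1 := by
  unfold HalfCycle at h
  have h1 : i + 1 - k = (i - k) + 1 := by ring
  rw [h1] at h
  set j := i - k with hj
  have hjv := ZMod.val_lt j
  suffices hs : 2 * (j + 1) = 0 by
    have : 2 * k - 1 - i - (i + 1) = - (2 * (j + 1)) := by rw [hj]; ring
    rw [hs, neg_zero] at this
    exact sub_eq_zero.mp this
  have hj1 : j + 1 = ((j.val + 1 : ℕ) : ZMod N) := by simp
  obtain ⟨M, rfl⟩ := hN
  rcases Nat.lt_or_ge (j.val + 1) (M + M) with hlt | hge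
  · have hv : (j + 1).val = j.val + 1 := by rw [hj1, ZMod.val_cast_of_lt hlt]
    rw [hv] at h
    have hM : j.val + 1 = M := by omega
    rw [hj1, hM, two_mul]
    have := ZMod.natCast_self (M + M)
    push_cast at this
    exact this
  · have hM : j.val + 1 = M + M := by omega
    rw [hj1, hM, ZMod.natCast_self, mul_zero]

open Classical in
/-- The number of places where a cyclic sequence changes its value. -/
def wallCount {N : ℕ} [NeZero N] {α : Type*} (τ : ZMod N → α) : ℕ :=
  ∑ i, if τ i = τ (i + 1) then 0 else 1

/-- The reflection `i ↦ c - i`. -/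
def reflectEquiv {N : ℕ} (c : ZMod N) : ZMod N ≃ ZMod N := Equiv.subLeft c

/-- Away from the cut, one fold sees a bond of `τ` and the other sees its mirror image, so the
totals agree. A bond at the cut joins a place to its own mirror image and is never a wall after
folding; cutting at a wall makes the inequality strict. -/
theorem wallCount_fold_lt {N : ℕ} [NeZero N] (hN : Even N) {α : Type*} (τ : ZMod N → α)
    (i₀ : ZMod N) (h₀ : τ i₀ ≠ τ (i₀ + 1)) :
    wallCount (foldIn (i₀ + 1) τ) + wallCount (foldOut (i₀ + 1) τ) < 2 * wallCount τ := by
  classical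
  set k := i₀ + 1 with hk
  have hsym : wallCount τ = ∑ i, if τ (2 * k - 1 - i) = τ (2 * k - 1 - (i + 1)) then 0 else 1 := by
    unfold wallCount
    rw [← (reflectEquiv (2 * k - 2)).sum_comp]
    refine Finset.sum_congr rfl fun i _ => ?_
    have e1 : reflectEquiv (2 * k - 2) i = 2 * k - 1 - (i + 1) := by
      simp only [reflectEquiv, Equiv.subLeft_apply]; ring
    have e2 : 2 * k - 1 - (i + 1) + 1 = 2 * k - 1 - i := by ring
    rw [e1, e2]
    simp only [eq_comm]
  rw [two_mul]
  nth_rewrite 2 [hsym]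
  unfold wallCount
  rw [← Finset.sum_add_distrib, ← Finset.sum_add_distrib]
  have hcross : ∀ i, ¬ (HalfCycle k i ↔ HalfCycle k (i + 1)) →
      foldIn k τ i = foldIn k τ (i + 1) ∧ foldOut k τ i = foldOut k τ (i + 1) := by
    intro i hi
    have hr := reflect_eq_add_one hN k i hi
    have hr' : 2 * k - 1 - (i + 1) = i := by rw [← hr]; ring
    unfold foldIn foldOut
    rw [hr, hr']
    by_cases h1 : HalfCycle k i <;> by_cases h2 : HalfCycle k (i + 1) <;> simp_all
  refine Finset.sum_lt_sum (fun i _ => ?_) ⟨i₀, Finset.mem_univ _, ?_⟩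
  · by_cases hi : (HalfCycle k i ↔ HalfCycle k (i + 1))
    · unfold foldIn foldOut
      by_cases h1 : HalfCycle k i
      · rw [if_pos h1, if_pos h1, if_pos (hi.1 h1), if_pos (hi.1 h1)]
      · have h2 : ¬ HalfCycle k (i + 1) := fun h => h1 (hi.2 h)
        rw [if_neg h1, if_neg h1, if_neg h2, if_neg h2, add_comm]
    · obtain ⟨h1, h2⟩ := hcross i hi
      rw [if_pos h1, if_pos h2]
      exact Nat.zero_le _
  · have hi : ¬ (HalfCycle k i₀ ↔ HalfCycle k (i₀ + 1)) := by
      have := halfCycle_reflect hN k i₀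
      have e : 2 * k - 1 - i₀ = i₀ + 1 := by rw [hk]; ring
      rw [e] at this
      tauto
    obtain ⟨h1, h2⟩ := hcross i₀ hi
    rw [if_pos h1, if_pos h2, if_neg h₀]
    omega

/-- At each place the two folds together carry the values of `τ` there and at the mirror image. -/
theorem prod_fold {N : ℕ} [NeZero N] {α : Type*} (p : α → ℝ) (k : ZMod N) (τ : ZMod N → α) :
    (∏ i, p (foldIn k τ i)) * ∏ i, p (foldOut k τ i) = (∏ i, p (τ i)) ^ 2 := by
  have hsym : ∏ i, p (τ i) = ∏ i, p (τ (2 * k - 1 - i)) :=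
    ((reflectEquiv (2 * k - 1)).prod_comp fun i => p (τ i)).symm
  rw [sq]
  nth_rewrite 2 [hsym]
  rw [← Finset.prod_mul_distrib, ← Finset.prod_mul_distrib]
  refine Finset.prod_congr rfl fun i _ => ?_
  unfold foldIn foldOut
  split_ifs
  · rfl
  · exact mul_comm _ _

theorem eq_of_wallCount_eq_zero {N : ℕ} [NeZero N] {α : Type*} (τ : ZMod N → α)
    (h : wallCount τ = 0) : τ = fun _ => τ 0 := by
  have h1 : ∀ i, τ (i + 1) = τ i := by
    intro i
    have := (Finset.sum_eq_zero_iff.mp h) i (Finset.mem_univ _)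
    by_contra hne
    rw [if_neg (fun h => hne h.symm)] at this
    exact one_ne_zero this
  have h2 : ∀ n : ℕ, τ (n : ZMod N) = τ 0 := by
    intro n
    induction n with
    | zero => simp
    | succ n ih => push_cast; rw [h1, ih]
  funext i
  rw [← h2 i.val, ZMod.natCast_zmod_val]

/-- The chessboard estimate on a cycle of even length. -/
theorem chessboard_cycle {N : ℕ} [NeZero N] (hN : Even N) {α : Type*} [Finite α]
    (R : (ZMod N → α) → ℝ) (p : α → ℝ) (hp : ∀ a, 0 < p a) (hR : ∀ τ, 0 ≤ R τ)
    (hfold : ∀ k τ, R τ ^ 2 ≤ R (foldIn k τ) * R (foldOut k τ))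
    (hconst : ∀ a, R (fun _ => a) ≤ p a ^ N) (τ : ZMod N → α) :
    R τ ≤ ∏ i, p (τ i) := by
  classical
  set Q : (ZMod N → α) → ℝ := fun τ => R τ / ∏ i, p (τ i) with hQ
  have hpp : ∀ τ : ZMod N → α, 0 < ∏ i, p (τ i) := fun τ => Finset.prod_pos fun i _ => hp _
  have hQ0 : ∀ τ, 0 ≤ Q τ := fun τ => div_nonneg (hR τ) (hpp τ).le
  have hQfold : ∀ k τ, Q τ ^ 2 ≤ Q (foldIn k τ) * Q (foldOut k τ) := by
    intro k τ
    simp only [hQ]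
    rw [div_mul_div_comm, prod_fold, div_pow]
    exact div_le_div_of_nonneg_right (hfold k τ) (sq_nonneg _)
  suffices hQ1 : Q τ ≤ 1 by
    simpa only [hQ, div_le_one (hpp τ)] using hQ1
  have : Nonempty (ZMod N → α) := ⟨τ⟩
  obtain ⟨τm, hτm⟩ := Finite.exists_max Q
  by_contra hlt
  push Not at hlt
  have hm1 : 1 < Q τm := lt_of_lt_of_le hlt (hτm τ)
  -- Among the maximisers of `Q`, one with the fewest walls is constant: otherwise folding at a wall
  -- gives two maximisers, one of which has fewer walls.
  let P : Set (ZMod N → α) := {σ | Q σ = Q τm}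
  have hP : P.Nonempty := ⟨τm, rfl⟩
  obtain ⟨σ, hσ, hmin⟩ := Set.exists_min_image P wallCount (Set.toFinite P) hP
  have hσ' : Q σ = Q τm := hσ
  rcases Nat.eq_zero_or_pos (wallCount σ) with h0 | hpos
  · have hc := eq_of_wallCount_eq_zero σ h0
    have : Q σ ≤ 1 := by
      rw [hc]
      simp only [hQ, Finset.prod_const, Finset.card_univ, ZMod.card]
      rw [div_le_one (pow_pos (hp _) _)]
      exact hconst _
    linarith
  · obtain ⟨i₀, h₀⟩ : ∃ i, σ i ≠ σ (i + 1) := by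
      by_contra hall
      push Not at hall
      have : wallCount σ = 0 := Finset.sum_eq_zero fun i _ => if_pos (hall i)
      omega
    have hw := wallCount_fold_lt hN σ i₀ h₀
    have hf := hQfold (i₀ + 1) σ
    have ha := hτm (foldIn (i₀ + 1) σ)
    have hb := hτm (foldOut (i₀ + 1) σ)
    have ha0 := hQ0 (foldIn (i₀ + 1) σ)
    have hb0 := hQ0 (foldOut (i₀ + 1) σ)
    rw [hσ'] at hf
    -- If `M ^ 2 ≤ a * b` with `0 ≤ a, b ≤ M` and `M > 0`, then `a = b = M`.
    have ha' : Q (foldIn (i₀ + 1) σ) = Q τm := le_antisymm ha (by nlinarith)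
    have hb' : Q (foldOut (i₀ + 1) σ) = Q τm := le_antisymm hb (by nlinarith)
    have := hmin _ ha'
    have := hmin _ hb'
    omega

/-! ### Reflection positivity of a finite Ising model -/

section Reflection

variable {Λ S : Type*} [DecidableEq Λ]

/-- The configuration that is `z` on the fixed part of `A`, `a` on the rest of `A`, and the
reflection of `b` elsewhere. -/
def glue (θ : Λ → Λ) (A : Set Λ) [DecidablePred (· ∈ A)] (hcover : ∀ x, x ∈ A ∨ θ x ∈ A)
    (hinv : Function.Involutive θ)
    (z : {x // x ∈ A ∧ θ x = x} → S) (a b : {x // x ∈ A ∧ θ x ≠ x} → S) (x : Λ) : S :=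
  if h : x ∈ A then
    if h' : θ x = x then z ⟨x, h, h'⟩ else a ⟨x, h, h'⟩
  else b ⟨θ x, (hcover x).resolve_left h, fun h' => h (by
    rw [hinv x] at h'; rw [h']; exact (hcover x).resolve_left h)⟩

theorem glue_reflect (θ : Λ → Λ) (A : Set Λ) [DecidablePred (· ∈ A)]
    (hcover : ∀ x, x ∈ A ∨ θ x ∈ A) (hfix : ∀ x, x ∈ A → θ x ∈ A → θ x = x)
    (hinv : Function.Involutive θ)
    (z : {x // x ∈ A ∧ θ x = x} → S) (a b : {x // x ∈ A ∧ θ x ≠ x} → S) :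
    glue θ A hcover hinv z a b ∘ θ = glue θ A hcover hinv z b a := by
  funext x
  simp only [Function.comp, glue]
  by_cases h : x ∈ A
  · by_cases h' : θ x = x
    · simp [h, h']
    · have h2 : θ x ∉ A := fun h2 => h' (hfix x h h2)
      simp [h, h', h2, hinv x]
  · have h2 : θ x ∈ A := (hcover x).resolve_left h
    have h3 : ¬ (x = θ x) := fun e => h (e ▸ h2)
    simp [h, h2, hinv x, h3]

/-- Configurations are triples: the values on the plane, and those on the two sides. -/
def glueEquiv (θ : Λ → Λ) (A : Set Λ) [DecidablePred (· ∈ A)]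
    (hcover : ∀ x, x ∈ A ∨ θ x ∈ A) (hfix : ∀ x, x ∈ A → θ x ∈ A → θ x = x)
    (hinv : Function.Involutive θ) :
    (({x // x ∈ A ∧ θ x = x} → S) × ({x // x ∈ A ∧ θ x ≠ x} → S) ×
    ({x // x ∈ A ∧ θ x ≠ x} → S)) ≃ (Λ → S) where
  toFun q := glue θ A hcover hinv q.1 q.2.1 q.2.2
  invFun η := (fun x => η x, fun x => η x, fun x => η (θ x))
  left_inv := by
    rintro ⟨z, a, b⟩
    refine Prod.ext (funext fun x => ?_) (Prod.ext (funext fun x => ?_) (funext fun x => ?_))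
    · simp [glue, x.2.1, x.2.2]
    · simp [glue, x.2.1, x.2.2]
    · have h2 : θ x ∉ A := fun h2 => x.2.2 (hfix x x.2.1 h2)
      simp [glue, h2, hinv x.1]
  right_inv := by
    intro η
    funext x
    simp only [glue]
    split_ifs
    · rfl
    · rfl
    · simp [hinv x]

/-- The Cauchy–Schwarz inequality of reflection positivity. -/
theorem reflection_cauchySchwarz [Fintype Λ] [Fintype S] (θ : Λ → Λ) (A : Set Λ)
    [DecidablePred (· ∈ A)] (hcover : ∀ x, x ∈ A ∨ θ x ∈ A)
    (hfix : ∀ x, x ∈ A → θ x ∈ A → θ x = x) (hinv : Function.Involutive θ) (G H : (Λ → S) → ℝ)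
    (hG : ∀ η η', (∀ x ∈ A, η x = η' x) → G η = G η')
    (hH : ∀ η η', (∀ x ∈ A, η x = η' x) → H η = H η') :
    (∑ η, G η * H (η ∘ θ)) ^ 2 ≤ (∑ η, G η * G (η ∘ θ)) * ∑ η, H η * H (η ∘ θ) := by
  -- With the mirror spins `z` fixed, the two sides are independent and the sum factorises;
  -- Cauchy–Schwarz is then applied to the sum over `z`.
  have key : ∀ G H : (Λ → S) → ℝ,
      (∀ η η', (∀ x ∈ A, η x = η' x) → G η = G η') →
      (∀ η η', (∀ x ∈ A, η x = η' x) → H η = H η') →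
      ∑ η, G η * H (η ∘ θ) = ∑ z, (∑ a, G (glue θ A hcover hinv z a a)) *
        ∑ a, H (glue θ A hcover hinv z a a) := by
    intro G H hG hH
    rw [← (glueEquiv θ A hcover hfix hinv).sum_comp, Fintype.sum_prod_type]
    refine Finset.sum_congr rfl fun z _ => ?_
    rw [Fintype.sum_prod_type, Finset.sum_mul_sum]
    refine Finset.sum_congr rfl fun a _ => Finset.sum_congr rfl fun b _ => ?_
    have h1 : ∀ a b : {x // x ∈ A ∧ θ x ≠ x} → S, ∀ x ∈ A,
        glue θ A hcover hinv z a b x = glue θ A hcover hinv z a a x := by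
      intro a b x hx
      simp [glue, hx]
    simp only [glueEquiv, Equiv.coe_fn_mk]
    rw [glue_reflect θ A hcover hfix hinv, hG _ _ (h1 a b), hH _ _ (h1 b a)]
  rw [key G H hG hH, key G G hG hG, key H H hH hH]
  simp only [← sq]
  exact Finset.sum_mul_sq_le_sq_mul_sq _ _ _

end Reflection

/-! ### Ising weights split along a mirror -/

section Ising

variable {Λ E : Type*} [Fintype Λ] [Fintype E]

/-- The exponent of the Ising weight with coupling `κ` on the edges `src e — tgt e` and field
`f`. -/
def isingExponent (src tgt : E → Λ) (κ : ℝ) (f : Λ → ℝ) (η : Λ → ℤˣ) : ℝ :=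
  κ * ∑ e, (((η (src e) : ℤ) : ℝ) * ((η (tgt e) : ℤ) : ℝ)) + ∑ x, f x * ((η x : ℤ) : ℝ)

/-- The spins are not constant on `K`. -/
def Mixed (K : Set Λ) (η : Λ → ℤˣ) : Prop := ∃ x ∈ K, ∃ y ∈ K, η x ≠ η y

open Classical in
/-- The total weight of the configurations that are mixed on each of the blocks in `B`. -/
def mixedWeight {ι : Type*} [DecidableEq Λ] (src tgt : E → Λ) (κ : ℝ) (f : Λ → ℝ)
    (K : ι → Set Λ) (B : Set ι) : ℝ :=
  ∑ η : Λ → ℤˣ, if ∀ b ∈ B, Mixed (K b) η then Real.exp (isingExponent src tgt κ f η) else 0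

theorem mixedWeight_nonneg {ι : Type*} [DecidableEq Λ] (src tgt : E → Λ) (κ : ℝ) (f : Λ → ℝ)
    (K : ι → Set Λ) (B : Set ι) : 0 ≤ mixedWeight src tgt κ f K B := by
  refine Finset.sum_nonneg fun η _ => ?_
  split_ifs
  · exact (Real.exp_pos _).le
  · exact le_rfl

-- Since every edge lies on one closed side, the exponent splits with no interaction term across the
-- mirror; this is why no sign condition on `κ` is needed.
open Classical in
theorem exists_half_exponent (src tgt : E → Λ) (κ : ℝ) (f : Λ → ℝ) (θ : Λ → Λ) (Θ : E → E)
    (A : Set Λ) (hinv : Function.Involutive θ) (hInv : Function.Involutive Θ)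
    (hsrc : ∀ e, src (Θ e) = θ (src e)) (htgt : ∀ e, tgt (Θ e) = θ (tgt e))
    (hf : ∀ x, f (θ x) = f x) (hcover : ∀ x, x ∈ A ∨ θ x ∈ A)
    (hedge : ∀ e, (src e ∈ A ∧ tgt e ∈ A) ∨ (θ (src e) ∈ A ∧ θ (tgt e) ∈ A)) :
    ∃ V : (Λ → ℤˣ) → ℝ, (∀ η η', (∀ x ∈ A, η x = η' x) → V η = V η') ∧
      ∀ η, isingExponent src tgt κ f η = V η + V (η ∘ θ) := by
  -- Weight 1 for edges lying only in `A`, 0 for those lying only in its mirror image, 1/2 for those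
  -- in both.
  let c : E → ℝ := fun e => (1 + (if src e ∈ A ∧ tgt e ∈ A then 1 else 0) -
    (if θ (src e) ∈ A ∧ θ (tgt e) ∈ A then 1 else 0)) / 2
  let d : Λ → ℝ := fun x => (1 + (if x ∈ A then 1 else 0) - (if θ x ∈ A then 1 else 0)) / 2
  have hc : ∀ e, c e + c (Θ e) = 1 := by
    intro e
    simp only [c, hsrc, htgt, hinv (src e), hinv (tgt e)]
    ring
  have hd : ∀ x, d x + d (θ x) = 1 := by
    intro x
    simp only [d, hinv x]
    ring
  refine ⟨fun η => κ * ∑ e, c e * (((η (src e) : ℤ) : ℝ) * ((η (tgt e) : ℤ) : ℝ)) +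
    ∑ x, d x * (f x * ((η x : ℤ) : ℝ)), ?_, ?_⟩
  · intro η η' h
    have h1 : ∀ e, c e * (((η (src e) : ℤ) : ℝ) * ((η (tgt e) : ℤ) : ℝ)) =
        c e * (((η' (src e) : ℤ) : ℝ) * ((η' (tgt e) : ℤ) : ℝ)) := by
      intro e
      by_cases he : src e ∈ A ∧ tgt e ∈ A
      · rw [h _ he.1, h _ he.2]
      · have hz : c e = 0 := by
          simp only [c, if_neg he, if_pos ((hedge e).resolve_left he)]
          norm_num
        rw [hz, zero_mul, zero_mul]
    have h2 : ∀ x, d x * (f x * ((η x : ℤ) : ℝ)) = d x * (f x * ((η' x : ℤ) : ℝ)) := by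
      intro x
      by_cases hx : x ∈ A
      · rw [h _ hx]
      · have hz : d x = 0 := by
          simp only [d, if_neg hx, if_pos ((hcover x).resolve_left hx)]
          norm_num
        rw [hz, zero_mul, zero_mul]
    simp only [h1, h2]
  · intro η
    have h1 : ∑ e, c e * ((((η ∘ θ) (src e) : ℤ) : ℝ) * (((η ∘ θ) (tgt e) : ℤ) : ℝ)) =
        ∑ e, c (Θ e) * (((η (src e) : ℤ) : ℝ) * ((η (tgt e) : ℤ) : ℝ)) := by
      rw [← Equiv.sum_comp (hInv.toPerm Θ)]
      refine Finset.sum_congr rfl fun e _ => ?_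
      simp only [Function.Involutive.coe_toPerm, Function.comp, hsrc, htgt, hinv (src e),
        hinv (tgt e)]
    have h2 : ∑ x, d x * (f x * (((η ∘ θ) x : ℤ) : ℝ)) =
        ∑ x, d (θ x) * (f x * ((η x : ℤ) : ℝ)) := by
      rw [← Equiv.sum_comp (hinv.toPerm θ)]
      refine Finset.sum_congr rfl fun x _ => ?_
      simp only [Function.Involutive.coe_toPerm, Function.comp, hinv x, hf]
    beta_reduce
    rw [h1, h2]
    have h3 : ∑ e, (((η (src e) : ℤ) : ℝ) * ((η (tgt e) : ℤ) : ℝ)) =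
        ∑ e, c e * (((η (src e) : ℤ) : ℝ) * ((η (tgt e) : ℤ) : ℝ)) +
        ∑ e, c (Θ e) * (((η (src e) : ℤ) : ℝ) * ((η (tgt e) : ℤ) : ℝ)) := by
      rw [← Finset.sum_add_distrib]
      refine Finset.sum_congr rfl fun e _ => ?_
      rw [← add_mul, hc, one_mul]
    have h4 : ∑ x, f x * ((η x : ℤ) : ℝ) = ∑ x, d x * (f x * ((η x : ℤ) : ℝ)) +
        ∑ x, d (θ x) * (f x * ((η x : ℤ) : ℝ)) := by
      rw [← Finset.sum_add_distrib]
      refine Finset.sum_congr rfl fun e _ => ?_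
      rw [← add_mul, hd, one_mul]
    rw [isingExponent, h3, h4]
    ring

open Classical in
/-- Reflection inequality for the weights of mixed blocks. -/
theorem mixedWeight_sq_le {ι : Type*} [DecidableEq Λ] (src tgt : E → Λ) (κ : ℝ) (f : Λ → ℝ)
    (θ : Λ → Λ) (Θ : E → E)
    (A : Set Λ) (hinv : Function.Involutive θ) (hInv : Function.Involutive Θ)
    (hsrc : ∀ e, src (Θ e) = θ (src e)) (htgt : ∀ e, tgt (Θ e) = θ (tgt e))
    (hf : ∀ x, f (θ x) = f x) (hcover : ∀ x, x ∈ A ∨ θ x ∈ A)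
    (hfix : ∀ x, x ∈ A → θ x ∈ A → θ x = x)
    (hedge : ∀ e, (src e ∈ A ∧ tgt e ∈ A) ∨ (θ (src e) ∈ A ∧ θ (tgt e) ∈ A))
    (K : ι → Set Λ) (ρ : ι → ι) (hρ : Function.Involutive ρ)
    (hK : ∀ b x, x ∈ K (ρ b) ↔ θ x ∈ K b) (L : Set ι) (hL : ∀ b, ρ b ∈ L ↔ b ∉ L)
    (hLA : ∀ b ∈ L, K b ⊆ A) (B : Set ι) :
    mixedWeight src tgt κ f K B ^ 2 ≤
      mixedWeight src tgt κ f K {b | if b ∈ L then b ∈ B else ρ b ∈ B} *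
      mixedWeight src tgt κ f K {b | if b ∈ L then ρ b ∈ B else b ∈ B} := by
  obtain ⟨V, hV, hUV⟩ := exists_half_exponent src tgt κ f θ Θ A hinv hInv hsrc htgt hf hcover hedge
  have hmix : ∀ b η, Mixed (K b) (η ∘ θ) ↔ Mixed (K (ρ b)) η := by
    intro b η
    constructor
    · rintro ⟨x, hx, y, hy, hxy⟩
      exact ⟨θ x, (hK b _).2 (by rwa [hinv x]), θ y, (hK b _).2 (by rwa [hinv y]), hxy⟩
    · rintro ⟨x, hx, y, hy, hxy⟩
      refine ⟨θ x, (hK b _).1 hx, θ y, (hK b _).1 hy, ?_⟩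
      simpa only [Function.comp, hinv x, hinv y] using hxy
  have hmixA : ∀ b ∈ L, ∀ η η' : Λ → ℤˣ, (∀ x ∈ A, η x = η' x) →
      (Mixed (K b) η ↔ Mixed (K b) η') := by
    intro b hb η η' h
    refine exists_congr fun x => and_congr_right fun hx =>
      exists_congr fun y => and_congr_right fun hy => ?_
    rw [h x (hLA b hb hx), h y (hLA b hb hy)]
  have half : ∀ C D : Set ι, (∑ η : Λ → ℤˣ,
      (if ∀ b ∈ L, b ∈ C → Mixed (K b) η then Real.exp (V η) else 0) *
      (if ∀ b ∈ L, b ∈ D → Mixed (K b) (η ∘ θ) then Real.exp (V (η ∘ θ)) else 0)) =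
      mixedWeight src tgt κ f K {b | if b ∈ L then b ∈ C else ρ b ∈ D} := by
    intro C D
    refine Finset.sum_congr rfl fun η _ => ?_
    have h1 : (∀ b ∈ {b | if b ∈ L then b ∈ C else ρ b ∈ D}, Mixed (K b) η) ↔
        (∀ b ∈ L, b ∈ C → Mixed (K b) η) ∧ ∀ b ∈ L, b ∈ D → Mixed (K b) (η ∘ θ) := by
      constructor
      · intro h
        refine ⟨fun b hb hC => h b (by simp [hb, hC]), fun b hb hD => ?_⟩
        rw [hmix]
        refine h _ ?_
        have : ρ b ∉ L := fun h' => (hL b).1 h' hb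
        simp [this, hρ b, hD]
      · rintro ⟨h, h'⟩ b hb
        by_cases hbL : b ∈ L
        · exact h b hbL (by simpa [hbL] using hb)
        · have := h' (ρ b) ((hL b).2 hbL) (by simpa [hbL] using hb)
          rwa [hmix, hρ b] at this
    by_cases h2 : (∀ b ∈ L, b ∈ C → Mixed (K b) η)
    · by_cases h3 : (∀ b ∈ L, b ∈ D → Mixed (K b) (η ∘ θ))
      · rw [if_pos h2, if_pos h3, if_pos (h1.2 ⟨h2, h3⟩), hUV, Real.exp_add]
      · rw [if_neg h3, mul_zero, if_neg (fun h => h3 (h1.1 h).2)]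
    · rw [if_neg h2, zero_mul, if_neg (fun h => h2 (h1.1 h).1)]
  have hdep : ∀ C : Set ι, ∀ η η' : Λ → ℤˣ, (∀ x ∈ A, η x = η' x) →
      (if ∀ b ∈ L, b ∈ C → Mixed (K b) η then Real.exp (V η) else 0) =
      (if ∀ b ∈ L, b ∈ C → Mixed (K b) η' then Real.exp (V η') else 0) := by
    intro C η η' h
    rw [hV η η' h]
    refine if_congr (forall_congr' fun b => ?_) rfl rfl
    refine forall_congr' fun hb => ?_
    rw [hmixA b hb η η' h]
  -- The first factor records the blocks of `B` inside `L`; the second records, after reflection,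
  -- those outside.
  have hcs := reflection_cauchySchwarz θ A hcover hfix hinv
    (fun η : Λ → ℤˣ => if ∀ b ∈ L, b ∈ B → Mixed (K b) η then Real.exp (V η) else 0)
    (fun η : Λ → ℤˣ => if ∀ b ∈ L, b ∈ {b | ρ b ∈ B} → Mixed (K b) η then Real.exp (V η) else 0)
    (hdep _) (hdep _)
  simp only [half] at hcs
  have e1 : {b | if b ∈ L then b ∈ B else ρ b ∈ {b | ρ b ∈ B}} = B := by
    ext b
    simp [hρ b]
  have e2 : {b | if b ∈ L then b ∈ {b | ρ b ∈ B} else ρ b ∈ {b | ρ b ∈ B}} =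
      {b | if b ∈ L then ρ b ∈ B else b ∈ B} := by
    ext b
    simp [hρ b]
  rwa [e1, e2] at hcs

end Ising

/-! ### Arcs and blocks on the doubled circle -/

/-- The circle of half-integer positions around a direction of the torus. -/
abbrev Circ (N L : ℕ) : Type := ZMod (2 * (N * L))

/-- The half circle that starts at the `k`-th reflection point. -/
def halfArc (N L : ℕ) (k : ℤ) : Set (Circ N L) :=
  {x | ∃ z : ℤ, 2 * L * k ≤ z ∧ z ≤ 2 * L * k + N * L ∧ (z : Circ N L) = x}

/-- The closed interval between the reflection points `b` and `b + 1`. -/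
def blockArc (N L : ℕ) (b : ZMod N) : Set (Circ N L) :=
  {x | ∃ i : ℤ, (i : ZMod N) = b ∧ ∃ z : ℤ, 2 * L * i ≤ z ∧ z ≤ 2 * L * (i + 1) ∧
    (z : Circ N L) = x}

/-- The reflection about the `k`-th reflection point. -/
def circReflect (N L : ℕ) (k : ℤ) (x : Circ N L) : Circ N L := ((4 * L * k : ℤ) : Circ N L) - x

section
variable {N L : ℕ}

theorem circ_eq_iff (a b : ℤ) :
    (a : Circ N L) = (b : Circ N L) ↔ ∃ q : ℤ, b - a = 2 * (N * L) * q := by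
  rw [ZMod.intCast_eq_intCast_iff_dvd_sub]
  push_cast
  rfl

theorem circReflect_intCast (k z : ℤ) :
    circReflect N L k (z : Circ N L) = ((4 * L * k - z : ℤ) : Circ N L) := by
  rw [circReflect, Int.cast_sub]

theorem exists_lift [NeZero N] [NeZero L] (a : ℤ) (x : Circ N L) :
    ∃ z : ℤ, a ≤ z ∧ z < a + 2 * (N * L) ∧ (z : Circ N L) = x := by
  obtain ⟨w, rfl⟩ := ZMod.intCast_surjective x
  have hpos : (0 : ℤ) < 2 * (N * L) := by
    have := NeZero.pos N
    have := NeZero.pos L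
    positivity
  refine ⟨a + (w - a) % (2 * (N * L)), ?_, ?_, ?_⟩
  · have := Int.emod_nonneg (w - a) hpos.ne'
    omega
  · have := Int.emod_lt_of_pos (w - a) hpos
    omega
  · rw [circ_eq_iff]
    refine ⟨(w - a) / (2 * (N * L)), ?_⟩
    have := Int.emod_add_mul_ediv (w - a) (2 * (N * L))
    linarith

theorem halfArc_cover_edge [NeZero N] [NeZero L] (k : ℤ) (x : Circ N L) :
    (x ∈ halfArc N L k ∧ x + 1 ∈ halfArc N L k) ∨
      (circReflect N L k x ∈ halfArc N L k ∧ circReflect N L k (x + 1) ∈ halfArc N L k) := by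
  -- The window of representatives is centred at the mirror point: its right half is the arc, its
  -- left half reflects into it.
  obtain ⟨z, h1, h2, rfl⟩ := exists_lift (2 * L * k - N * L) x
  have e : ((z : Circ N L) + 1) = ((z + 1 : ℤ) : Circ N L) := by push_cast; rfl
  rw [e, circReflect_intCast, circReflect_intCast]
  have h4 : 4 * (L : ℤ) * k = 2 * (2 * L * k) := by ring
  rcases le_or_gt (2 * L * k) z with h | h
  · exact Or.inl ⟨⟨z, h, by linarith, rfl⟩, ⟨z + 1, by linarith, by linarith, rfl⟩⟩
  · exact Or.inr ⟨⟨_, by linarith, by linarith, rfl⟩, ⟨_, by linarith, by linarith, rfl⟩⟩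

theorem halfArc_cover [NeZero N] [NeZero L] (k : ℤ) (x : Circ N L) :
    x ∈ halfArc N L k ∨ circReflect N L k x ∈ halfArc N L k :=
  (halfArc_cover_edge k x).imp (fun h => h.1) fun h => h.1

theorem halfArc_fix [NeZero N] [NeZero L] (k : ℤ) (x : Circ N L) (hx : x ∈ halfArc N L k)
    (hx' : circReflect N L k x ∈ halfArc N L k) : circReflect N L k x = x := by
  obtain ⟨z, h1, h2, rfl⟩ := hx
  obtain ⟨w, h3, h4, h5⟩ := hx'
  rw [circReflect_intCast] at h5 ⊢
  obtain ⟨q, hq⟩ := (circ_eq_iff _ _).1 h5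
  have hpos : (0 : ℤ) < N * L := by
    have := NeZero.pos N
    have := NeZero.pos L
    positivity
  have hq0 : 2 * (N * L) * (-1) ≤ 2 * (N * L : ℤ) * q := by
    rw [← hq]; linarith
  have hq1 : 2 * (N * L : ℤ) * q ≤ 2 * (N * L) * 0 := by
    rw [← hq]; linarith
  have hq0' : -1 ≤ q := le_of_mul_le_mul_left hq0 (by positivity)
  have hq1' : q ≤ 0 := le_of_mul_le_mul_left hq1 (by positivity)
  rw [← h5]
  congr 1
  -- The reflection has two fixed points: `q = 0` is the mirror point itself, `q = -1` its antipode.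
  rcases (by omega : q = -1 ∨ q = 0) with rfl | rfl <;> linarith

theorem zmod_eq_iff (a b : ℤ) :
    (a : ZMod N) = (b : ZMod N) ↔ ∃ q : ℤ, b - a = N * q := by
  rw [ZMod.intCast_eq_intCast_iff_dvd_sub]
  rfl

/-- The half circle at `k` is made of the `N / 2` consecutive arcs starting with the `k`-th, so
geometric halves match the combinatorial ones used for folding. -/
theorem blockArc_subset_halfArc [NeZero N] (hN : Even N) (k : ℤ) (b : ZMod N)
    (hb : HalfCycle (k : ZMod N) b) : blockArc N L b ⊆ halfArc N L k := by
  rintro x ⟨i, rfl, z, h1, h2, rfl⟩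
  obtain ⟨M, hM⟩ := hN
  unfold HalfCycle at hb
  set r := ((i : ZMod N) - (k : ZMod N)).val with hr
  have hr' : ((k + r : ℤ) : ZMod N) = (i : ZMod N) := by
    push_cast
    rw [hr, ZMod.natCast_zmod_val]
    ring
  obtain ⟨q, hq⟩ := (zmod_eq_iff _ _).1 hr'
  have hrM : (r : ℤ) + 1 ≤ M := by omega
  have hi : i = k + r + N * q := by linarith
  have hL : (0 : ℤ) ≤ L := by positivity
  refine ⟨z - 2 * (N * L) * q, ?_, ?_, ?_⟩
  · rw [hi] at h1
    nlinarith [mul_nonneg hL (Int.natCast_nonneg r)]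
  · rw [hi] at h2
    have hNM : (N : ℤ) = 2 * M := by rw [hM]; push_cast; ring
    have : (L : ℤ) * (r + 1) ≤ L * M := mul_le_mul_of_nonneg_left hrM hL
    have h3 : 2 * (L : ℤ) * (k + r + N * q + 1) =
      2 * L * k + 2 * (L * (r + 1)) + 2 * (N * L) * q := by ring
    have h4 : (N : ℤ) * L = 2 * (L * M) := by rw [hNM]; ring
    linarith
  · rw [circ_eq_iff]
    exact ⟨q, by ring⟩

theorem mem_blockArc_reflect (k : ℤ) (b : ZMod N) (x : Circ N L) :
    x ∈ blockArc N L (2 * (k : ZMod N) - 1 - b) ↔ circReflect N L k x ∈ blockArc N L b := by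
  have key : ∀ (b : ZMod N) (x : Circ N L), x ∈ blockArc N L b →
      circReflect N L k x ∈ blockArc N L (2 * (k : ZMod N) - 1 - b) := by
    rintro b x ⟨i, rfl, z, h1, h2, rfl⟩
    refine ⟨2 * k - 1 - i, by push_cast; rfl, 4 * L * k - z, by linarith, by linarith, ?_⟩
    rw [circReflect_intCast]
  constructor
  · intro h
    have := key _ _ h
    rwa [sub_sub_cancel] at this
  · intro h
    have := key _ _ h
    rwa [circReflect, circReflect, sub_sub_cancel] at this

theorem exists_two_blocks [NeZero N] [NeZero L] (x : Circ N L) :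
    ∃ b c : ZMod N, ∀ d, x ∈ blockArc N L d → d = b ∨ d = c := by
  obtain ⟨z, rfl⟩ := ZMod.intCast_surjective x
  have hL : (0 : ℤ) < 2 * L := by
    have := NeZero.pos L
    positivity
  refine ⟨((z / (2 * L) : ℤ) : ZMod N), ((z / (2 * L) - 1 : ℤ) : ZMod N), ?_⟩
  rintro d ⟨i, rfl, w, h1, h2, h3⟩
  obtain ⟨q, hq⟩ := (circ_eq_iff _ _).1 h3
  have hz : z = w + 2 * L * (N * q) := by linarith
  have hdiv : z / (2 * L) = w / (2 * L) + N * q := by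
    rw [hz, Int.add_mul_ediv_left _ _ hL.ne']
  rcases h2.lt_or_eq with h | h
  · left
    have hw : w / (2 * L) = i :=
      le_antisymm (Int.lt_add_one_iff.1 (Int.ediv_lt_of_lt_mul hL (by linarith)))
        (Int.le_ediv_of_mul_le hL (by linarith))
    rw [hdiv, hw]
    push_cast
    simp
  · right
    have hw : w / (2 * L) = i + 1 := by
      rw [h, Int.mul_ediv_cancel_left _ hL.ne']
    rw [hdiv, hw]
    push_cast
    simp

end

/-- Doubling, as a map from the circle of sites. -/
def dbl (N L : ℕ) : ZMod (N * L) →+ Circ N L :=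
  ZMod.lift (N * L) ⟨(Int.castAddHom (Circ N L)).comp (AddMonoidHom.mulLeft (2 : ℤ)), by
    have := ZMod.natCast_self (2 * (N * L))
    push_cast at this
    simpa using this⟩

section
variable {N L : ℕ}

theorem dbl_intCast (z : ℤ) : dbl N L (z : ZMod (N * L)) = ((2 * z : ℤ) : Circ N L) := by
  rw [dbl, ZMod.lift_coe]
  rfl

theorem dbl_injective : Function.Injective (dbl N L) := by
  intro x y h
  obtain ⟨a, rfl⟩ := ZMod.intCast_surjective x
  obtain ⟨b, rfl⟩ := ZMod.intCast_surjective y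
  rw [dbl_intCast, dbl_intCast, circ_eq_iff] at h
  obtain ⟨q, hq⟩ := h
  rw [ZMod.intCast_eq_intCast_iff_dvd_sub]
  refine ⟨q, ?_⟩
  push_cast
  linarith

end

/-! ### The field of the cell board -/

/-- The sign of the cell of a coordinate: `1` and `-1` alternate along the circle. -/
def cellSign {N L : ℕ} (x : ZMod (N * L)) : ℝ := (((x.val : ℤ) / (L : ℤ)).negOnePow : ℤ)

theorem negOnePow_add_even (a b : ℤ) (hb : Even b) : (a + b).negOnePow = a.negOnePow := by
  rw [Int.negOnePow_add, Int.negOnePow_even b hb, mul_one]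

theorem cellSign_intCast {N L : ℕ} [NeZero N] [NeZero L] (hN : Even N) (z : ℤ) :
    cellSign (z : ZMod (N * L)) = ((z / (L : ℤ)).negOnePow : ℤ) := by
  have hL : (L : ℤ) ≠ 0 := by exact_mod_cast NeZero.ne L
  unfold cellSign
  rw [ZMod.val_intCast]
  have h1 : z = z % ((N * L : ℕ) : ℤ) + L * (N * (z / ((N * L : ℕ) : ℤ))) := by
    have := Int.emod_add_mul_ediv z ((N * L : ℕ) : ℤ)
    push_cast at this ⊢
    linarith
  conv_rhs => rw [h1]
  rw [Int.add_mul_ediv_left _ _ hL, negOnePow_add_even]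
  obtain ⟨M, rfl⟩ := hN
  exact ⟨M * (z / (((M + M) * L : ℕ) : ℤ)), by push_cast; ring⟩

theorem field_eq {L₁ L₂ : ℕ} [NeZero L₁] [NeZero L₂] (h : ℝ) (a b : ℤ) :
    field L₁ L₂ h (a, b) =
      h * (((a / (L₁ : ℤ)).negOnePow : ℤ) * ((b / (L₂ : ℤ)).negOnePow : ℤ)) := by
  have h1 : (0 : ℤ) < L₁ := by exact_mod_cast NeZero.pos L₁
  have h2 : (0 : ℤ) < L₂ := by exact_mod_cast NeZero.pos L₂
  have hmem : (a, b) ∈ zPlus L₁ L₂ ↔ Even (a / (L₁ : ℤ) + b / (L₂ : ℤ)) := by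
    constructor
    · rintro ⟨n, m, hnm, c1, c2, c3, c4⟩
      have ea : a / (L₁ : ℤ) = n :=
        le_antisymm (Int.lt_add_one_iff.1 (Int.ediv_lt_of_lt_mul h1 c2))
          (Int.le_ediv_of_mul_le h1 c1)
      have eb : b / (L₂ : ℤ) = m :=
        le_antisymm (Int.lt_add_one_iff.1 (Int.ediv_lt_of_lt_mul h2 c4))
          (Int.le_ediv_of_mul_le h2 c3)
      rwa [ea, eb]
    · intro h
      exact ⟨_, _, h, Int.ediv_mul_le _ h1.ne', Int.lt_ediv_add_one_mul_self _ h1,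
        Int.ediv_mul_le _ h2.ne', Int.lt_ediv_add_one_mul_self _ h2⟩
  have hprod : (((a / (L₁ : ℤ)).negOnePow : ℤ) : ℝ) * (((b / (L₂ : ℤ)).negOnePow : ℤ) : ℝ) =
      (((a / (L₁ : ℤ) + b / (L₂ : ℤ)).negOnePow : ℤ) : ℝ) := by
    rw [Int.negOnePow_add]
    push_cast
    rfl
  rw [hprod]
  unfold field
  by_cases he : Even (a / (L₁ : ℤ) + b / (L₂ : ℤ))
  · rw [if_pos (hmem.2 he), Int.negOnePow_even _ he]
    simp
  · rw [if_neg (fun hh => he (hmem.1 hh)), Int.negOnePow_odd _ (Int.not_even_iff_odd.1 he)]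
    simp

theorem torusField_eq {N L₁ L₂ : ℕ} [NeZero L₁] [NeZero L₂] (h : ℝ)
    (s : Torus N L₁ L₂) : torusField N L₁ L₂ h s = h * (cellSign s.1 * cellSign s.2) :=
  field_eq h _ _

/-- Reflecting about the centre of cell `k` turns the cell index `n` into `2 * k - n`, which has the
same parity. -/
theorem cellSign_reflect {N L : ℕ} [NeZero N] [NeZero L] (hN : Even N) (k : ℤ)
    (x : ZMod (N * L)) : cellSign (((L - 1 + 2 * L * k : ℤ) : ZMod (N * L)) - x) = cellSign x := by
  obtain ⟨z, rfl⟩ := ZMod.intCast_surjective x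
  have hL : (0 : ℤ) < L := by exact_mod_cast NeZero.pos L
  rw [← Int.cast_sub, cellSign_intCast hN, cellSign_intCast hN]
  have h0 := Int.emod_nonneg z hL.ne'
  have h1 := Int.emod_lt_of_pos z hL
  have h2 := Int.emod_add_mul_ediv z L
  have e : (L - 1 + 2 * L * k - z) / (L : ℤ) = z / (L : ℤ) + 2 * (k - z / (L : ℤ)) := by
    apply le_antisymm
    · apply Int.lt_add_one_iff.1
      apply Int.ediv_lt_of_lt_mul hL
      linarith
    · apply Int.le_ediv_of_mul_le hL
      linarith
  rw [e, negOnePow_add_even _ _ (even_two_mul _)]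

/-! ### The decorated model -/

/-- The sites and the bonds (horizontal, vertical) of the torus. -/
abbrev Deco (N L₁ L₂ : ℕ) : Type := Torus N L₁ L₂ ⊕ (Torus N L₁ L₂ ⊕ Torus N L₁ L₂)

/-- Half-bonds: a site `t`, a direction (`false` is the first), and an end of the bond. -/
abbrev HalfBond (N L₁ L₂ : ℕ) : Type := Torus N L₁ L₂ × Bool × Bool

section
variable {N L₁ L₂ : ℕ}

/-- The site of a half-bond. -/
def halfSrc : HalfBond N L₁ L₂ → Deco N L₁ L₂
  | (t, _, false) => .inl t
  | (t, false, true) => .inl (t + (1, 0))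
  | (t, true, true) => .inl (t + (0, 1))

/-- The bond of a half-bond. -/
def halfTgt : HalfBond N L₁ L₂ → Deco N L₁ L₂
  | (t, false, _) => .inr (.inl t)
  | (t, true, _) => .inr (.inr t)

/-- The first coordinate, doubled and centred. -/
def posX : Deco N L₁ L₂ → Circ N L₁
  | .inl t => dbl N L₁ t.1 - (L₁ - 1)
  | .inr (.inl t) => dbl N L₁ t.1 + 1 - (L₁ - 1)
  | .inr (.inr t) => dbl N L₁ t.1 - (L₁ - 1)

/-- The second coordinate, doubled and centred. -/
def posY : Deco N L₁ L₂ → Circ N L₂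
  | .inl t => dbl N L₂ t.2 - (L₂ - 1)
  | .inr (.inl t) => dbl N L₂ t.2 - (L₂ - 1)
  | .inr (.inr t) => dbl N L₂ t.2 + 1 - (L₂ - 1)

/-- The centre of the `k`-th reflection of the circle of sites. -/
def siteCentre (N L : ℕ) (k : ℤ) : ZMod (N * L) := ((L - 1 + 2 * L * k : ℤ) : ZMod (N * L))

/-- Reflection in the first direction. -/
def reflectX (k : ℤ) : Deco N L₁ L₂ → Deco N L₁ L₂
  | .inl t => .inl (siteCentre N L₁ k - t.1, t.2)
  | .inr (.inl t) => .inr (.inl (siteCentre N L₁ k - 1 - t.1, t.2))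
  | .inr (.inr t) => .inr (.inr (siteCentre N L₁ k - t.1, t.2))

/-- Reflection in the second direction. -/
def reflectY (k : ℤ) : Deco N L₁ L₂ → Deco N L₁ L₂
  | .inl t => .inl (t.1, siteCentre N L₂ k - t.2)
  | .inr (.inl t) => .inr (.inl (t.1, siteCentre N L₂ k - t.2))
  | .inr (.inr t) => .inr (.inr (t.1, siteCentre N L₂ k - 1 - t.2))

/-- Reflection of the half-bonds in the first direction. -/
def reflectEdgeX (k : ℤ) : HalfBond N L₁ L₂ → HalfBond N L₁ L₂
  | (t, false, b) => ((siteCentre N L₁ k - 1 - t.1, t.2), false, !b)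
  | (t, true, b) => ((siteCentre N L₁ k - t.1, t.2), true, b)

/-- Reflection of the half-bonds in the second direction. -/
def reflectEdgeY (k : ℤ) : HalfBond N L₁ L₂ → HalfBond N L₁ L₂
  | (t, false, b) => ((t.1, siteCentre N L₂ k - t.2), false, b)
  | (t, true, b) => ((t.1, siteCentre N L₂ k - 1 - t.2), true, !b)

/-- The field of the decorated model. -/
def decoField (h β : ℝ) : Deco N L₁ L₂ → ℝ
  | .inl t => β * torusField N L₁ L₂ h t
  | .inr _ => 0

/-- The closed block with index `b`. -/
def block (b : ZMod N × ZMod N) : Set (Deco N L₁ L₂) :=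
  {p | posX p ∈ blockArc N L₁ b.1 ∧ posY p ∈ blockArc N L₂ b.2}

theorem dbl_one : dbl N L₁ 1 = 2 := by
  have := dbl_intCast (N := N) (L := L₁) 1
  push_cast at this
  simpa using this

theorem dbl_siteCentre (k : ℤ) :
    dbl N L₁ (siteCentre N L₁ k) = 2 * (L₁ - 1) + ((4 * L₁ * k : ℤ) : Circ N L₁) := by
  rw [siteCentre, dbl_intCast]
  push_cast
  ring

theorem posX_reflectX (k : ℤ) (p : Deco N L₁ L₂) :
    posX (reflectX k p) = circReflect N L₁ k (posX p) := by
  rcases p with t | t | t <;>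
    simp only [posX, reflectX, circReflect, map_sub, dbl_siteCentre, dbl_one] <;> ring

theorem posY_reflectX (k : ℤ) (p : Deco N L₁ L₂) : posY (reflectX k p) = posY p := by
  rcases p with t | t | t <;> rfl

theorem posY_reflectY (k : ℤ) (p : Deco N L₁ L₂) :
    posY (reflectY k p) = circReflect N L₂ k (posY p) := by
  rcases p with t | t | t <;>
    simp only [posY, reflectY, circReflect, map_sub, dbl_siteCentre, dbl_one] <;> ring

theorem posX_reflectY (k : ℤ) (p : Deco N L₁ L₂) : posX (reflectY k p) = posX p := by
  rcases p with t | t | t <;> rfl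

theorem reflectX_involutive (k : ℤ) :
    Function.Involutive (reflectX (N := N) (L₁ := L₁) (L₂ := L₂) k) := by
  intro p
  rcases p with t | t | t <;> simp [reflectX]

theorem reflectY_involutive (k : ℤ) :
    Function.Involutive (reflectY (N := N) (L₁ := L₁) (L₂ := L₂) k) := by
  intro p
  rcases p with t | t | t <;> simp [reflectY]

theorem reflectEdgeX_involutive (k : ℤ) :
    Function.Involutive (reflectEdgeX (N := N) (L₁ := L₁) (L₂ := L₂) k) := by
  rintro ⟨t, _ | _, b⟩ <;> simp [reflectEdgeX]

theorem reflectEdgeY_involutive (k : ℤ) :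
    Function.Involutive (reflectEdgeY (N := N) (L₁ := L₁) (L₂ := L₂) k) := by
  rintro ⟨t, _ | _, b⟩ <;> simp [reflectEdgeY]

theorem halfSrc_reflectEdgeX (k : ℤ) (e : HalfBond N L₁ L₂) :
    halfSrc (reflectEdgeX k e) = reflectX k (halfSrc e) := by
  rcases e with ⟨t, _ | _, _ | _⟩ <;>
    simp [halfSrc, reflectEdgeX, reflectX] <;> ring

theorem halfSrc_reflectEdgeY (k : ℤ) (e : HalfBond N L₁ L₂) :
    halfSrc (reflectEdgeY k e) = reflectY k (halfSrc e) := by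
  rcases e with ⟨t, _ | _, _ | _⟩ <;>
    simp [halfSrc, reflectEdgeY, reflectY] <;> ring

theorem halfTgt_reflectEdgeX (k : ℤ) (e : HalfBond N L₁ L₂) :
    halfTgt (reflectEdgeX k e) = reflectX k (halfTgt e) := by
  rcases e with ⟨t, _ | _, _ | _⟩ <;> rfl

theorem halfTgt_reflectEdgeY (k : ℤ) (e : HalfBond N L₁ L₂) :
    halfTgt (reflectEdgeY k e) = reflectY k (halfTgt e) := by
  rcases e with ⟨t, _ | _, _ | _⟩ <;> rfl

theorem decoField_reflectX [NeZero N] [NeZero L₁] [NeZero L₂] (hN : Even N) (h β : ℝ) (k : ℤ)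
    (p : Deco N L₁ L₂) : decoField h β (reflectX k p) = decoField h β p := by
  rcases p with t | t | t
  · simp only [decoField, reflectX, torusField_eq, siteCentre, cellSign_reflect hN]
  · rfl
  · rfl

theorem decoField_reflectY [NeZero N] [NeZero L₁] [NeZero L₂] (hN : Even N) (h β : ℝ) (k : ℤ)
    (p : Deco N L₁ L₂) : decoField h β (reflectY k p) = decoField h β p := by
  rcases p with t | t | t
  · simp only [decoField, reflectY, torusField_eq, siteCentre, cellSign_reflect hN]
  · rfl
  · rfl

theorem reflectX_eq_self (k : ℤ) (p : Deco N L₁ L₂)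
    (hp : posX (reflectX k p) = posX p) : reflectX k p = p := by
  rcases p with t | t | t <;> simp only [posX, reflectX, sub_left_inj, add_left_inj] at hp ⊢ <;>
    rw [dbl_injective hp]

theorem reflectY_eq_self (k : ℤ) (p : Deco N L₁ L₂)
    (hp : posY (reflectY k p) = posY p) : reflectY k p = p := by
  rcases p with t | t | t <;> simp only [posY, reflectY, sub_left_inj, add_left_inj] at hp ⊢ <;>
    rw [dbl_injective hp]

/-- In doubled coordinates a half-bond has length at most one, while mirrors sit at integer
positions; hence no half-bond jumps across a mirror. This is what the decoration is for. -/
theorem posX_halfBond (e : HalfBond N L₁ L₂) :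
    posX (halfSrc e) = posX (halfTgt e) ∨ posX (halfTgt e) = posX (halfSrc e) + 1 ∨
      posX (halfSrc e) = posX (halfTgt e) + 1 := by
  rcases e with ⟨t, _ | _, _ | _⟩
  · right; left; simp only [posX, halfSrc, halfTgt]; ring
  · right; right; simp only [posX, halfSrc, halfTgt, Prod.fst_add, map_add, dbl_one]; ring
  · left; rfl
  · left; simp [posX, halfSrc, halfTgt]

theorem posY_halfBond (e : HalfBond N L₁ L₂) :
    posY (halfSrc e) = posY (halfTgt e) ∨ posY (halfTgt e) = posY (halfSrc e) + 1 ∨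
      posY (halfSrc e) = posY (halfTgt e) + 1 := by
  rcases e with ⟨t, _ | _, _ | _⟩
  · left; rfl
  · left; simp [posY, halfSrc, halfTgt]
  · right; left; simp only [posY, halfSrc, halfTgt]; ring
  · right; right; simp only [posY, halfSrc, halfTgt, Prod.snd_add, map_add, dbl_one]; ring

theorem edge_in_half {L : ℕ} [NeZero N] [NeZero L] (k : ℤ) (x y : Circ N L)
    (h : x = y ∨ y = x + 1 ∨ x = y + 1) :
    (x ∈ halfArc N L k ∧ y ∈ halfArc N L k) ∨
      (circReflect N L k x ∈ halfArc N L k ∧ circReflect N L k y ∈ halfArc N L k) := by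
  rcases h with rfl | rfl | rfl
  · exact (halfArc_cover k x).imp (fun h => ⟨h, h⟩) fun h => ⟨h, h⟩
  · exact halfArc_cover_edge k x
  · exact (halfArc_cover_edge k y).imp And.symm And.symm

/-! ### Reflection inequalities and the chessboard estimate for blocks -/

/-- The weight of the configurations that are mixed on the blocks of `B`. -/
def decoWeight [NeZero N] [NeZero L₁] [NeZero L₂] (κ h β : ℝ) (B : Set (ZMod N × ZMod N)) : ℝ :=
  mixedWeight (halfSrc (N := N) (L₁ := L₁) (L₂ := L₂)) halfTgt κ (decoField h β) block B

open Classical in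
theorem decoWeight_sq_le_X [NeZero N] [NeZero L₁] [NeZero L₂] (hN : Even N) (κ h β : ℝ)
    (k : ZMod N) (B : Set (ZMod N × ZMod N)) :
    decoWeight (L₁ := L₁) (L₂ := L₂) κ h β B ^ 2 ≤
      decoWeight (L₁ := L₁) (L₂ := L₂) κ h β
        {b | if HalfCycle k b.1 then b ∈ B else (2 * k - 1 - b.1, b.2) ∈ B} *
      decoWeight (L₁ := L₁) (L₂ := L₂) κ h β
        {b | if HalfCycle k b.1 then (2 * k - 1 - b.1, b.2) ∈ B else b ∈ B} := by
  obtain ⟨k, rfl⟩ := ZMod.intCast_surjective k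
  refine mixedWeight_sq_le halfSrc halfTgt κ (decoField h β) (reflectX k) (reflectEdgeX k)
    {p | posX p ∈ halfArc N L₁ k} (reflectX_involutive k) (reflectEdgeX_involutive k)
    (halfSrc_reflectEdgeX k) (halfTgt_reflectEdgeX k) (decoField_reflectX hN h β k) ?_ ?_ ?_
    block (fun b => (2 * k - 1 - b.1, b.2)) ?_ ?_ {b | HalfCycle (k : ZMod N) b.1} ?_ ?_ B
  · intro p
    simp only [Set.mem_ofPred_eq, posX_reflectX]
    exact halfArc_cover k _
  · intro p hp hp'
    simp only [Set.mem_ofPred_eq, posX_reflectX] at hp hp'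
    exact reflectX_eq_self k p (by rw [posX_reflectX, halfArc_fix k _ hp hp'])
  · intro e
    simp only [Set.mem_ofPred_eq, posX_reflectX]
    exact edge_in_half k _ _ (posX_halfBond e)
  · intro b
    simp
  · intro b p
    simp only [block, Set.mem_ofPred_eq, posX_reflectX, posY_reflectX, mem_blockArc_reflect]
  · intro b
    exact halfCycle_reflect hN _ _
  · intro b hb p hp
    exact blockArc_subset_halfArc hN k _ hb hp.1

open Classical in
theorem decoWeight_sq_le_Y [NeZero N] [NeZero L₁] [NeZero L₂] (hN : Even N) (κ h β : ℝ)
    (k : ZMod N) (B : Set (ZMod N × ZMod N)) :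
    decoWeight (L₁ := L₁) (L₂ := L₂) κ h β B ^ 2 ≤
      decoWeight (L₁ := L₁) (L₂ := L₂) κ h β
        {b | if HalfCycle k b.2 then b ∈ B else (b.1, 2 * k - 1 - b.2) ∈ B} *
      decoWeight (L₁ := L₁) (L₂ := L₂) κ h β
        {b | if HalfCycle k b.2 then (b.1, 2 * k - 1 - b.2) ∈ B else b ∈ B} := by
  obtain ⟨k, rfl⟩ := ZMod.intCast_surjective k
  refine mixedWeight_sq_le halfSrc halfTgt κ (decoField h β) (reflectY k) (reflectEdgeY k)
    {p | posY p ∈ halfArc N L₂ k} (reflectY_involutive k) (reflectEdgeY_involutive k)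
    (halfSrc_reflectEdgeY k) (halfTgt_reflectEdgeY k) (decoField_reflectY hN h β k) ?_ ?_ ?_
    block (fun b => (b.1, 2 * k - 1 - b.2)) ?_ ?_ {b | HalfCycle (k : ZMod N) b.2} ?_ ?_ B
  · intro p
    simp only [Set.mem_ofPred_eq, posY_reflectY]
    exact halfArc_cover k _
  · intro p hp hp'
    simp only [Set.mem_ofPred_eq, posY_reflectY] at hp hp'
    exact reflectY_eq_self k p (by rw [posY_reflectY, halfArc_fix k _ hp hp'])
  · intro e
    simp only [Set.mem_ofPred_eq, posY_reflectY]
    exact edge_in_half k _ _ (posY_halfBond e)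
  · intro b
    simp
  · intro b p
    simp only [block, Set.mem_ofPred_eq, posX_reflectY, posY_reflectY, mem_blockArc_reflect]
  · intro b
    exact halfCycle_reflect hN _ _
  · intro b hb p hp
    exact blockArc_subset_halfArc hN k _ hb hp.2

open Classical in
/-- The chessboard estimate for mixed blocks. -/
theorem decoWeight_le_pow [NeZero N] [NeZero L₁] [NeZero L₂] (hN : Even N) (κ h β ε : ℝ)
    (hε : 0 < ε) (hall : decoWeight (N := N) (L₁ := L₁) (L₂ := L₂) κ h β Set.univ ≤
      ε ^ (N ^ 2) * decoWeight (N := N) (L₁ := L₁) (L₂ := L₂) κ h β ∅)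
    (hpos : 0 < decoWeight (N := N) (L₁ := L₁) (L₂ := L₂) κ h β ∅)
    (B : Finset (ZMod N × ZMod N)) :
    decoWeight (L₁ := L₁) (L₂ := L₂) κ h β (B : Set (ZMod N × ZMod N)) ≤
      ε ^ B.card * decoWeight (N := N) (L₁ := L₁) (L₂ := L₂) κ h β ∅ := by
  set W := decoWeight (N := N) (L₁ := L₁) (L₂ := L₂) κ h β with hW
  have hW0 : ∀ B, 0 ≤ W B := fun B => mixedWeight_nonneg _ _ _ _ _ _
  let R : Set (ZMod N × ZMod N) → ℝ := fun B => W B / W ∅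
  have hR0 : ∀ B, 0 ≤ R B := fun B => div_nonneg (hW0 B) hpos.le
  have hdiv : ∀ B B₁ B₂, W B ^ 2 ≤ W B₁ * W B₂ → R B ^ 2 ≤ R B₁ * R B₂ := by
    intro B B₁ B₂ hB
    simp only [R]
    rw [div_pow, div_mul_div_comm, ← sq]
    exact div_le_div_of_nonneg_right hB (sq_nonneg _)
  have hfull : R Set.univ ≤ (ε ^ N) ^ N := by
    simp only [R]
    rw [div_le_iff₀ hpos, ← pow_mul, ← sq]
    exact hall
  -- Patterns independent of the first coordinate: folding in the second direction reduces them to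
  -- the full and the empty pattern.
  have hcol : ∀ a : Set (ZMod N), R {b | b.2 ∈ a} ≤
      ∏ j : ZMod N, if j ∈ a then ε ^ N else 1 := by
    intro a
    refine chessboard_cycle hN (fun σ : ZMod N → Prop => R {b | σ b.2})
      (fun q : Prop => if q then ε ^ N else 1) ?_ (fun σ => hR0 _) ?_ ?_ (fun j => j ∈ a)
    · intro q
      split_ifs
      · exact pow_pos hε _
      · exact one_pos
    · intro k σ
      have := hdiv _ _ _ (decoWeight_sq_le_Y (L₁ := L₁) (L₂ := L₂) hN κ h β k {b | σ b.2})
      convert this using 4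
      · simp only [foldIn, Set.mem_ofPred_eq]
      · simp only [foldOut, Set.mem_ofPred_eq]
    · intro q
      by_cases hq : q
      · simp only [hq, if_true]
        exact hfull
      · simp only [hq, if_false, one_pow]
        have : ({b | False} : Set (ZMod N × ZMod N)) = ∅ := by ext; simp
        rw [this]
        exact (div_self hpos.ne').le
  -- The value at a first coordinate is now a whole column of blocks; the constant sequences are the
  -- patterns treated by `hcol`.
  have hmain := chessboard_cycle hN (fun τ : ZMod N → Set (ZMod N) => R {b | b.2 ∈ τ b.1})
      (fun a => ∏ j : ZMod N, if j ∈ a then ε else 1) (fun a => Finset.prod_pos fun j _ => by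
        split_ifs
        · exact hε
        · exact one_pos) (fun τ => hR0 _) (by
        intro k τ
        have := hdiv _ _ _ (decoWeight_sq_le_X (L₁ := L₁) (L₂ := L₂) hN κ h β k {b | b.2 ∈ τ b.1})
        convert this using 4
        · simp only [foldIn, Set.mem_ofPred_eq]
          funext b
          split_ifs <;> rfl
        · simp only [foldOut, Set.mem_ofPred_eq]
          funext b
          split_ifs <;> rfl) (by
        intro a
        refine (hcol a).trans (le_of_eq ?_)
        rw [← Finset.prod_pow]
        refine Finset.prod_congr rfl fun j _ => ?_
        split_ifs <;> simp) (fun i => {j | (i, j) ∈ B})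
  have e1 : {b : ZMod N × ZMod N | b.2 ∈ {j | (b.1, j) ∈ B}} = (B : Set (ZMod N × ZMod N)) := by
    ext b
    simp
  have e2 : (∏ i : ZMod N, ∏ j : ZMod N, if j ∈ {j | (i, j) ∈ B} then ε else 1) = ε ^ B.card := by
    rw [← Fintype.prod_prod_type' (fun i j => if j ∈ {j | (i, j) ∈ B} then ε else 1)]
    simp only [Set.mem_ofPred_eq, Prod.mk.eta]
    rw [Finset.prod_ite]
    simp
  have hmain' : R (B : Set (ZMod N × ZMod N)) ≤ ε ^ B.card := by
    rw [← e1]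
    refine hmain.trans_eq ?_
    convert e2
  simpa only [R, div_le_iff₀ hpos] using hmain'

end

/-! ### The field as a divergence -/

/-- A flow on the circle whose divergence is `cellSign`. -/
def cellFlow {N L : ℕ} (x : ZMod (N * L)) : ℝ :=
  cellSign x * (((x.val : ℤ) % (L : ℤ) : ℤ) + 1 - (L : ℝ) / 2)

theorem cellFlow_intCast {N L : ℕ} [NeZero N] [NeZero L] (hN : Even N) (z : ℤ) :
    cellFlow (z : ZMod (N * L)) =
      (((z / (L : ℤ)).negOnePow : ℤ) : ℝ) * (((z % (L : ℤ) : ℤ) : ℝ) + 1 - (L : ℝ) / 2) := by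
  rw [cellFlow, cellSign_intCast hN, ZMod.val_intCast, Int.emod_emod_of_dvd]
  push_cast
  exact dvd_mul_left _ _

theorem abs_units_real (u : ℤˣ) : |((u : ℤ) : ℝ)| = 1 := by
  rcases Int.units_eq_one_or u with rfl | rfl <;> simp

theorem abs_cellSign {N L : ℕ} (x : ZMod (N * L)) : |cellSign x| = 1 := abs_units_real _

theorem abs_cellFlow_le {N L : ℕ} [NeZero L] (x : ZMod (N * L)) : |cellFlow x| ≤ (L : ℝ) / 2 := by
  have hL : (0 : ℤ) < L := by exact_mod_cast NeZero.pos L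
  rw [cellFlow, abs_mul, abs_cellSign, one_mul]
  have h0 : (0 : ℝ) ≤ ((x.val : ℤ) % (L : ℤ) : ℤ) := by
    exact_mod_cast Int.emod_nonneg (x.val : ℤ) hL.ne'
  have h1 : (((x.val : ℤ) % (L : ℤ) : ℤ) : ℝ) + 1 ≤ L := by
    exact_mod_cast Int.emod_lt_of_pos (x.val : ℤ) hL
  rw [abs_le]
  constructor <;> linarith

/-- The flow is linear of slope ±1 inside a cell and reaches `±L / 2` on leaving it. Centring by `L
/ 2` lets it continue with the opposite slope into the next cell. -/
theorem cellFlow_add_one_sub {N L : ℕ} [NeZero N] [NeZero L] (hN : Even N) (x : ZMod (N * L)) :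
    cellFlow (x + 1) - cellFlow x = cellSign (x + 1) := by
  obtain ⟨z, rfl⟩ := ZMod.intCast_surjective x
  have e : ((z : ZMod (N * L)) + 1) = ((z + 1 : ℤ) : ZMod (N * L)) := by push_cast; rfl
  have hL : (0 : ℤ) < L := by exact_mod_cast NeZero.pos L
  rw [e, cellFlow_intCast hN, cellFlow_intCast hN, cellSign_intCast hN]
  have h0 := Int.emod_nonneg z hL.ne'
  have h1 := Int.emod_lt_of_pos z hL
  have h2 := Int.emod_add_mul_ediv z L
  rcases (by omega : z % L + 1 < L ∨ z % L = L - 1) with h | h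
  · have hd : (z + 1) / (L : ℤ) = z / L :=
      le_antisymm (Int.lt_add_one_iff.1 (Int.ediv_lt_of_lt_mul hL (by linarith)))
        (Int.le_ediv_of_mul_le hL (by linarith))
    have hm : (z + 1) % (L : ℤ) = z % L + 1 := by
      have := Int.emod_add_mul_ediv (z + 1) L
      rw [hd] at this
      linarith
    rw [hd, hm]
    push_cast
    ring
  · have hd : (z + 1) / (L : ℤ) = z / L + 1 :=
      le_antisymm (Int.lt_add_one_iff.1 (Int.ediv_lt_of_lt_mul hL (by linarith)))
        (Int.le_ediv_of_mul_le hL (by linarith))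
    have hm : (z + 1) % (L : ℤ) = 0 := by
      have := Int.emod_add_mul_ediv (z + 1) L
      rw [hd] at this
      linarith
    rw [hd, hm, h, Int.negOnePow_succ]
    push_cast
    ring

/-! ### Frustrated half-bonds and the energy bound -/

section
variable {N L₁ L₂ : ℕ}

/-- The indicator of a frustrated half-bond. -/
def frust (η : Deco N L₁ L₂ → ℤˣ) (e : HalfBond N L₁ L₂) : ℝ :=
  if η (halfSrc e) ≠ η (halfTgt e) then 1 else 0

theorem abs_spin_sub (η : Deco N L₁ L₂ → ℤˣ) (e : HalfBond N L₁ L₂) :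
    |((η (halfSrc e) : ℤ) : ℝ) - ((η (halfTgt e) : ℤ) : ℝ)| = 2 * frust η e := by
  unfold frust
  rcases Int.units_eq_one_or (η (halfSrc e)) with h1 | h1 <;>
    rcases Int.units_eq_one_or (η (halfTgt e)) with h2 | h2 <;> rw [h1, h2] <;> norm_num

theorem spin_mul_spin (η : Deco N L₁ L₂ → ℤˣ) (e : HalfBond N L₁ L₂) :
    ((η (halfSrc e) : ℤ) : ℝ) * ((η (halfTgt e) : ℤ) : ℝ) = 1 - 2 * frust η e := by
  unfold frust
  rcases Int.units_eq_one_or (η (halfSrc e)) with h1 | h1 <;>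
    rcases Int.units_eq_one_or (η (halfTgt e)) with h2 | h2 <;> rw [h1, h2] <;> norm_num

theorem abs_bond_diff_le (η : Deco N L₁ L₂ → ℤˣ) (t : Torus N L₁ L₂) :
    |((η (.inl t) : ℤ) : ℝ) - ((η (.inl (t + (1, 0))) : ℤ) : ℝ)| ≤
        2 * ∑ b : Bool, frust η (t, false, b) ∧
      |((η (.inl t) : ℤ) : ℝ) - ((η (.inl (t + (0, 1))) : ℤ) : ℝ)| ≤
        2 * ∑ b : Bool, frust η (t, true, b) := by
  constructor
  · have h1 := abs_spin_sub η (t, false, false)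
    have h2 := abs_spin_sub η (t, false, true)
    simp only [halfSrc, halfTgt] at h1 h2
    have h3 := abs_sub_le ((η (.inl t) : ℤ) : ℝ) ((η (.inr (.inl t)) : ℤ) : ℝ)
      ((η (.inl (t + (1, 0))) : ℤ) : ℝ)
    rw [abs_sub_comm ((η (.inr (.inl t)) : ℤ) : ℝ)] at h3
    rw [Fintype.sum_bool]
    linarith
  · have h1 := abs_spin_sub η (t, true, false)
    have h2 := abs_spin_sub η (t, true, true)
    simp only [halfSrc, halfTgt] at h1 h2
    have h3 := abs_sub_le ((η (.inl t) : ℤ) : ℝ) ((η (.inr (.inr t)) : ℤ) : ℝ)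
      ((η (.inl (t + (0, 1))) : ℤ) : ℝ)
    rw [abs_sub_comm ((η (.inr (.inr t)) : ℤ) : ℝ)] at h3
    rw [Fintype.sum_bool]
    linarith

end

section
variable {N L₁ L₂ : ℕ} [NeZero N] [NeZero L₁] [NeZero L₂]

/-- Summation by parts around the torus, with no boundary term. -/
theorem sum_cellSign_mul_X (hN : Even N) (g : Torus N L₁ L₂ → ℝ) :
    ∑ t : Torus N L₁ L₂, cellSign t.1 * cellSign t.2 * g t =
      ∑ t : Torus N L₁ L₂, cellFlow t.1 * cellSign t.2 * (g t - g (t + (1, 0))) := by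
  have h1 : ∑ t : Torus N L₁ L₂, cellSign t.1 * cellSign t.2 * g t =
      ∑ t : Torus N L₁ L₂, cellSign (t + (1, 0)).1 * cellSign (t + (1, 0)).2 * g (t + (1, 0)) :=
    (Equiv.sum_comp (Equiv.addRight ((1, 0) : Torus N L₁ L₂))
      fun t => cellSign t.1 * cellSign t.2 * g t).symm
  have h2 : ∑ t : Torus N L₁ L₂, cellFlow t.1 * cellSign t.2 * g t =
      ∑ t : Torus N L₁ L₂, cellFlow (t + (1, 0)).1 * cellSign (t + (1, 0)).2 * g (t + (1, 0)) :=
    (Equiv.sum_comp (Equiv.addRight ((1, 0) : Torus N L₁ L₂))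
      fun t => cellFlow t.1 * cellSign t.2 * g t).symm
  simp only [mul_sub, Finset.sum_sub_distrib]
  rw [h1, h2, ← Finset.sum_sub_distrib]
  refine Finset.sum_congr rfl fun t _ => ?_
  simp only [Prod.fst_add, Prod.snd_add, add_zero]
  rw [← cellFlow_add_one_sub hN]
  ring

theorem sum_cellSign_mul_Y (hN : Even N) (g : Torus N L₁ L₂ → ℝ) :
    ∑ t : Torus N L₁ L₂, cellSign t.1 * cellSign t.2 * g t =
      ∑ t : Torus N L₁ L₂, cellSign t.1 * cellFlow t.2 * (g t - g (t + (0, 1))) := by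
  have h1 : ∑ t : Torus N L₁ L₂, cellSign t.1 * cellSign t.2 * g t =
      ∑ t : Torus N L₁ L₂, cellSign (t + (0, 1)).1 * cellSign (t + (0, 1)).2 * g (t + (0, 1)) :=
    (Equiv.sum_comp (Equiv.addRight ((0, 1) : Torus N L₁ L₂))
      fun t => cellSign t.1 * cellSign t.2 * g t).symm
  have h2 : ∑ t : Torus N L₁ L₂, cellSign t.1 * cellFlow t.2 * g t =
      ∑ t : Torus N L₁ L₂, cellSign (t + (0, 1)).1 * cellFlow (t + (0, 1)).2 * g (t + (0, 1)) :=
    (Equiv.sum_comp (Equiv.addRight ((0, 1) : Torus N L₁ L₂))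
      fun t => cellSign t.1 * cellFlow t.2 * g t).symm
  simp only [mul_sub, Finset.sum_sub_distrib]
  rw [h1, h2, ← Finset.sum_sub_distrib]
  refine Finset.sum_congr rfl fun t _ => ?_
  simp only [Prod.fst_add, Prod.snd_add, add_zero]
  rw [← cellFlow_add_one_sub hN]
  ring

/-- The half-bonds on which the two spins differ. -/
def frustrated (η : Deco N L₁ L₂ → ℤˣ) : Finset (HalfBond N L₁ L₂) :=
  Finset.univ.filter fun e => η (halfSrc e) ≠ η (halfTgt e)

theorem sum_frust (η : Deco N L₁ L₂ → ℤˣ) : ∑ e, frust η e = (frustrated η).card := by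
  simp only [frust, frustrated, Finset.sum_boole]

/-- The isoperimetric inequality: the field energy is dominated by the frustrated half-bonds. -/
theorem abs_sum_sign_le (hN : Even N) (η : Deco N L₁ L₂ → ℤˣ) :
    ((L₁ : ℝ) + L₂) *
      |∑ t : Torus N L₁ L₂, cellSign t.1 * cellSign t.2 * ((η (.inl t) : ℤ) : ℝ)| ≤
      L₁ * L₂ * (frustrated η).card := by
  set S := ∑ t : Torus N L₁ L₂, cellSign t.1 * cellSign t.2 * ((η (.inl t) : ℤ) : ℝ) with hS
  have hX : |S| ≤ L₁ * ∑ t : Torus N L₁ L₂, ∑ b : Bool, frust η (t, false, b) := by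
    rw [hS, sum_cellSign_mul_X hN, Finset.mul_sum]
    refine (Finset.abs_sum_le_sum_abs _ _).trans (Finset.sum_le_sum fun t _ => ?_)
    rw [abs_mul, abs_mul, abs_cellSign, mul_one]
    calc _ ≤ (L₁ : ℝ) / 2 * (2 * ∑ b : Bool, frust η (t, false, b)) :=
          mul_le_mul (abs_cellFlow_le _) (abs_bond_diff_le η t).1 (abs_nonneg _) (by positivity)
      _ = _ := by ring
  have hY : |S| ≤ L₂ * ∑ t : Torus N L₁ L₂, ∑ b : Bool, frust η (t, true, b) := by
    rw [hS, sum_cellSign_mul_Y hN, Finset.mul_sum]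
    refine (Finset.abs_sum_le_sum_abs _ _).trans (Finset.sum_le_sum fun t _ => ?_)
    rw [abs_mul, abs_mul, abs_cellSign, one_mul]
    calc _ ≤ (L₂ : ℝ) / 2 * (2 * ∑ b : Bool, frust η (t, true, b)) :=
          mul_le_mul (abs_cellFlow_le _) (abs_bond_diff_le η t).2 (abs_nonneg _) (by positivity)
      _ = _ := by ring
  have hD : ((frustrated η).card : ℝ) = ∑ t : Torus N L₁ L₂, ∑ b : Bool, frust η (t, false, b) +
      ∑ t : Torus N L₁ L₂, ∑ b : Bool, frust η (t, true, b) := by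
    rw [← sum_frust, Fintype.sum_prod_type, ← Finset.sum_add_distrib]
    refine Finset.sum_congr rfl fun t _ => ?_
    rw [Fintype.sum_prod_type, Fintype.sum_bool, add_comm]
  rw [hD]
  have h1 : (0 : ℝ) ≤ L₁ := by positivity
  have h2 : (0 : ℝ) ≤ L₂ := by positivity
  -- Weighting the horizontal bound by `L₂` and the vertical one by `L₁` gives every half-bond the
  -- same coefficient `L₁ * L₂`.
  have := mul_le_mul_of_nonneg_left hX h2
  have := mul_le_mul_of_nonneg_left hY h1
  linarith

theorem sum_decoField (h β : ℝ) (η : Deco N L₁ L₂ → ℤˣ) :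
    ∑ p, decoField h β p * ((η p : ℤ) : ℝ) =
      β * h * ∑ t : Torus N L₁ L₂, cellSign t.1 * cellSign t.2 * ((η (.inl t) : ℤ) : ℝ) := by
  rw [Fintype.sum_sum_type, Finset.mul_sum]
  simp only [decoField, zero_mul, Finset.sum_const_zero, add_zero, torusField_eq]
  exact Finset.sum_congr rfl fun t _ => by ring

theorem decoExponent_eq (κ h β : ℝ) (η : Deco N L₁ L₂ → ℤˣ) :
    isingExponent halfSrc halfTgt κ (decoField h β) η =
      κ * (Fintype.card (HalfBond N L₁ L₂) - 2 * (frustrated η).card) +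
      β * h * ∑ t : Torus N L₁ L₂, cellSign t.1 * cellSign t.2 * ((η (.inl t) : ℤ) : ℝ) := by
  rw [isingExponent, sum_decoField]
  simp only [spin_mul_spin, Finset.sum_sub_distrib, ← Finset.mul_sum, sum_frust]
  simp

/-- A frustrated half-bond costs `2 * κ ≥ 2 * β * J`, of which the field can win back at most `β * h
* L₁ * L₂ / (L₁ + L₂)`. -/
theorem decoExponent_le (hN : Even N) (J κ h β : ℝ) (hh : 0 < h) (hβ : 0 < β) (hκ : β * J ≤ κ)
    (η : Deco N L₁ L₂ → ℤˣ) :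
    isingExponent halfSrc halfTgt κ (decoField h β) η ≤
      κ * Fintype.card (HalfBond N L₁ L₂) -
        β * peierlsConst L₁ L₂ J h * (frustrated η).card := by
  rw [decoExponent_eq, peierlsConst]
  have hL : (0 : ℝ) < (L₁ : ℝ) + L₂ := by
    have : (0 : ℝ) < L₁ := by exact_mod_cast NeZero.pos L₁
    positivity
  have h1 := abs_sum_sign_le hN η
  set S := ∑ t : Torus N L₁ L₂, cellSign t.1 * cellSign t.2 * ((η (.inl t) : ℤ) : ℝ)
  set D : ℝ := ((frustrated η).card : ℝ)
  have hD : 0 ≤ D := Nat.cast_nonneg _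
  have h2 : S ≤ L₁ * L₂ / (L₁ + L₂) * D := by
    refine (le_abs_self S).trans ?_
    rw [div_mul_eq_mul_div, le_div_iff₀ hL]
    linarith
  have h3 : β * h * S ≤ β * h * (L₁ * L₂ / (L₁ + L₂) * D) :=
    mul_le_mul_of_nonneg_left h2 (by positivity)
  have h4 : β * J * D ≤ κ * D := mul_le_mul_of_nonneg_right hκ hD
  have h5 : β * (2 * J - h * L₁ * L₂ / (L₁ + L₂)) * D =
    2 * (β * J * D) - β * h * (L₁ * L₂ / (L₁ + L₂) * D) := by ring
  rw [h5]
  linarith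

/-- With nothing frustrated, the isoperimetric inequality forces the total field to vanish. -/
theorem decoExponent_one (hN : Even N) (κ h β : ℝ) :
    isingExponent halfSrc halfTgt κ (decoField h β) (fun _ : Deco N L₁ L₂ => 1) =
      κ * Fintype.card (HalfBond N L₁ L₂) := by
  have hz : (frustrated (fun _ : Deco N L₁ L₂ => (1 : ℤˣ))).card = 0 := by simp [frustrated]
  have h1 := abs_sum_sign_le hN (fun _ : Deco N L₁ L₂ => (1 : ℤˣ))
  have hL : (0 : ℝ) < (L₁ : ℝ) + L₂ := by
    have : (0 : ℝ) < L₁ := by exact_mod_cast NeZero.pos L₁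
    positivity
  rw [hz] at h1
  have h2 := abs_nonneg (∑ t : Torus N L₁ L₂, cellSign t.1 * cellSign t.2 * (((1 : ℤˣ) : ℤ) : ℝ))
  have h3 : (∑ t : Torus N L₁ L₂, cellSign t.1 * cellSign t.2 * (((1 : ℤˣ) : ℤ) : ℝ)) = 0 := by
    rw [← abs_eq_zero]
    apply le_antisymm _ h2
    by_contra hc
    push Not at hc
    have := mul_pos hL hc
    simp only [Nat.cast_zero, mul_zero] at h1
    linarith
  rw [decoExponent_eq, hz, h3]
  simp

/-! ### Entropy of frustrated half-bonds -/

theorem eq_of_add_one_eq {n : ℕ} [NeZero n] {α : Type*} (f : ZMod n → α)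
    (h : ∀ x, f x = f (x + 1)) (x y : ZMod n) : f x = f y := by
  have h2 : ∀ m : ℕ, f (m : ZMod n) = f 0 := by
    intro m
    induction m with
    | zero => simp
    | succ m ih => push_cast; rw [← h, ih]
  rw [← ZMod.natCast_zmod_val x, ← ZMod.natCast_zmod_val y, h2, h2]

theorem deco_const {α : Type*} (g : Deco N L₁ L₂ → α)
    (h : ∀ e : HalfBond N L₁ L₂, g (halfSrc e) = g (halfTgt e)) (p q : Deco N L₁ L₂) :
    g p = g q := by
  have hX : ∀ x y, g (.inl (x, y)) = g (.inl (x + 1, y)) := by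
    intro x y
    have h1 := h ((x, y), false, false)
    have h2 := h ((x, y), false, true)
    simp only [halfSrc, halfTgt, Prod.mk_add_mk, add_zero] at h1 h2
    rw [h1, h2]
  have hY : ∀ x y, g (.inl (x, y)) = g (.inl (x, y + 1)) := by
    intro x y
    have h1 := h ((x, y), true, false)
    have h2 := h ((x, y), true, true)
    simp only [halfSrc, halfTgt, Prod.mk_add_mk, add_zero] at h1 h2
    rw [h1, h2]
  have hs : ∀ t, g (.inl t) = g (.inl 0) := by
    rintro ⟨x, y⟩
    exact (eq_of_add_one_eq (fun x => g (.inl (x, y))) (fun x => hX x y) x 0).trans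
      (eq_of_add_one_eq (fun y => g (.inl (0, y))) (fun y => hY 0 y) y 0)
  have hp : ∀ p, g p = g (.inl 0) := by
    rintro (t | t | t)
    · exact hs t
    · exact (h (t, false, false)).symm.trans (hs t)
    · exact (h (t, true, false)).symm.trans (hs t)
  rw [hp p, hp q]

/-- If two configurations are frustrated on the same half-bonds, their product is unchanged along
every half-bond, hence constant because the decorated torus is connected. -/
theorem frustrated_injective :
    Function.Injective fun η : Deco N L₁ L₂ → ℤˣ => (η (.inl 0), frustrated η) := by
  intro η η' hη
  simp only [Prod.mk.injEq] at hη
  obtain ⟨h0, hF⟩ := hη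
  have hg : ∀ e : HalfBond N L₁ L₂, (η * η') (halfSrc e) = (η * η') (halfTgt e) := by
    intro e
    have he : e ∈ frustrated η ↔ e ∈ frustrated η' := by rw [hF]
    simp only [frustrated, Finset.mem_filter, Finset.mem_univ, true_and] at he
    simp only [Pi.mul_apply]
    rcases Int.units_eq_one_or (η (halfSrc e)) with h1 | h1 <;>
    rcases Int.units_eq_one_or (η (halfTgt e)) with h2 | h2 <;>
    rcases Int.units_eq_one_or (η' (halfSrc e)) with h3 | h3 <;>
    rcases Int.units_eq_one_or (η' (halfTgt e)) with h4 | h4 <;>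
    rw [h1, h2, h3, h4] at he ⊢ <;> revert he <;> decide
  funext p
  have := deco_const (η * η') hg p (.inl 0)
  simp only [Pi.mul_apply, h0, Int.units_mul_self] at this
  exact (mul_eq_one_iff_eq_inv.1 this).trans (Int.units_inv_eq_self _)

/-- Enlarge the sum to all pairs of a sign and a set of half-bonds, then use the binomial theorem.
-/
theorem sum_pow_frustrated_le (x : ℝ) (hx : 0 ≤ x) :
    ∑ η : Deco N L₁ L₂ → ℤˣ, x ^ (frustrated η).card ≤
      2 * (1 + x) ^ Fintype.card (HalfBond N L₁ L₂) := by
  classical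
  have h1 : ∑ η : Deco N L₁ L₂ → ℤˣ, x ^ (frustrated η).card =
      ∑ q ∈ Finset.univ.image (fun η : Deco N L₁ L₂ → ℤˣ => (η (.inl 0), frustrated η)),
        x ^ q.2.card := by
    rw [Finset.sum_image fun a _ b _ h => frustrated_injective h]
  rw [h1]
  refine (Finset.sum_le_univ_sum_of_nonneg fun q => pow_nonneg hx _).trans (le_of_eq ?_)
  rw [Fintype.sum_prod_type]
  have h2 := Fintype.sum_pow_mul_eq_add_pow (HalfBond N L₁ L₂) x 1
  simp only [one_pow, mul_one] at h2
  simp only [h2, Finset.sum_const, Finset.card_univ, Fintype.card_units_int, nsmul_eq_mul]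
  rw [add_comm]
  norm_num

end

/-! ### Geometry of the blocks -/

section
variable {N L : ℕ}

theorem exists_lift_of_mem_blockArc (i : ℤ) (x : Circ N L) (hx : x ∈ blockArc N L (i : ZMod N)) :
    ∃ z : ℤ, 2 * L * i ≤ z ∧ z ≤ 2 * L * (i + 1) ∧ (z : Circ N L) = x := by
  obtain ⟨j, hj, z, h1, h2, rfl⟩ := hx
  obtain ⟨q, hq⟩ := (zmod_eq_iff _ _).1 hj
  have hi : i = j + N * q := by linarith
  refine ⟨z + 2 * (N * L) * q, ?_, ?_, ?_⟩
  · rw [hi]; linarith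
  · rw [hi]; linarith
  · rw [circ_eq_iff]
    exact ⟨-q, by ring⟩

theorem mem_blockArc_intCast (i z : ℤ) (h1 : 2 * L * i ≤ z) (h2 : z ≤ 2 * L * (i + 1)) :
    (z : Circ N L) ∈ blockArc N L (i : ZMod N) := ⟨i, rfl, z, h1, h2, rfl⟩

theorem exists_half_of_dbl_eq (x : ZMod (N * L)) (w : ℤ) (h : dbl N L x = (w : Circ N L)) :
    ∃ a : ℤ, w = 2 * a ∧ (a : ZMod (N * L)) = x := by
  obtain ⟨b, rfl⟩ := ZMod.intCast_surjective x
  rw [dbl_intCast, circ_eq_iff] at h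
  obtain ⟨q, hq⟩ := h
  refine ⟨b + N * L * q, by linarith, ?_⟩
  rw [ZMod.intCast_eq_intCast_iff_dvd_sub]
  refine ⟨-q, ?_⟩
  push_cast
  ring

theorem eq_of_step {α : Type*} (f : ℤ → α) (lo hi : ℤ)
    (h : ∀ a, lo ≤ 2 * a → 2 * (a + 1) ≤ hi → f a = f (a + 1)) (a b : ℤ)
    (ha : lo ≤ 2 * a) (ha' : 2 * a ≤ hi) (hb : lo ≤ 2 * b) (hb' : 2 * b ≤ hi) : f a = f b := by
  have key : ∀ a b : ℤ, lo ≤ 2 * a → a ≤ b → 2 * b ≤ hi → f a = f b := by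
    intro a b ha hab
    induction b, hab using Int.leInduction with
    | base => intro _; rfl
    | succ n hn ih =>
      intro hn'
      rw [ih (by omega), h n (by omega) hn']
  rcases le_total a b with hab | hab
  · exact key a b ha hab hb'
  · exact (key b a hb hab ha').symm

end

section
variable {N L₁ L₂ : ℕ}

/-- The site with integer coordinates `a` and `b`. -/
def intSite (a b : ℤ) : Torus N L₁ L₂ := ((a : ZMod (N * L₁)), (b : ZMod (N * L₂)))

/-- In doubled, uncentred coordinates a block runs from the centre `2 * L₁ * i + (L₁ - 1)` of cell
`i` to the centre of the next cell, and likewise in the other direction. -/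
theorem mem_block_site (i j a b : ℤ) (h1 : 2 * L₁ * i + (L₁ - 1) ≤ 2 * a)
    (h2 : 2 * a ≤ 2 * L₁ * i + (L₁ - 1) + 2 * L₁) (h3 : 2 * L₂ * j + (L₂ - 1) ≤ 2 * b)
    (h4 : 2 * b ≤ 2 * L₂ * j + (L₂ - 1) + 2 * L₂) :
    (.inl (intSite a b) : Deco N L₁ L₂) ∈ block ((i : ZMod N), (j : ZMod N)) := by
  constructor
  · have := mem_blockArc_intCast (N := N) (L := L₁) i (2 * a - (L₁ - 1)) (by linarith)
      (by linarith)
    simpa only [posX, intSite, dbl_intCast, Int.cast_sub, Int.cast_natCast, Int.cast_one] using this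
  · have := mem_blockArc_intCast (N := N) (L := L₂) j (2 * b - (L₂ - 1)) (by linarith)
      (by linarith)
    simpa only [posY, intSite, dbl_intCast, Int.cast_sub, Int.cast_natCast, Int.cast_one] using this

theorem mem_block_hbond (i j a b : ℤ) (h1 : 2 * L₁ * i + (L₁ - 1) ≤ 2 * a + 1)
    (h2 : 2 * a + 1 ≤ 2 * L₁ * i + (L₁ - 1) + 2 * L₁) (h3 : 2 * L₂ * j + (L₂ - 1) ≤ 2 * b)
    (h4 : 2 * b ≤ 2 * L₂ * j + (L₂ - 1) + 2 * L₂) :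
    (.inr (.inl (intSite a b)) : Deco N L₁ L₂) ∈ block ((i : ZMod N), (j : ZMod N)) := by
  constructor
  · have := mem_blockArc_intCast (N := N) (L := L₁) i (2 * a + 1 - (L₁ - 1)) (by linarith)
      (by linarith)
    simpa only [posX, intSite, dbl_intCast, Int.cast_sub, Int.cast_natCast, Int.cast_one,
      Int.cast_add] using this
  · have := mem_blockArc_intCast (N := N) (L := L₂) j (2 * b - (L₂ - 1)) (by linarith)
      (by linarith)
    simpa only [posY, intSite, dbl_intCast, Int.cast_sub, Int.cast_natCast, Int.cast_one] using this

theorem mem_block_vbond (i j a b : ℤ) (h1 : 2 * L₁ * i + (L₁ - 1) ≤ 2 * a)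
    (h2 : 2 * a ≤ 2 * L₁ * i + (L₁ - 1) + 2 * L₁) (h3 : 2 * L₂ * j + (L₂ - 1) ≤ 2 * b + 1)
    (h4 : 2 * b + 1 ≤ 2 * L₂ * j + (L₂ - 1) + 2 * L₂) :
    (.inr (.inr (intSite a b)) : Deco N L₁ L₂) ∈ block ((i : ZMod N), (j : ZMod N)) := by
  constructor
  · have := mem_blockArc_intCast (N := N) (L := L₁) i (2 * a - (L₁ - 1)) (by linarith)
      (by linarith)
    simpa only [posX, intSite, dbl_intCast, Int.cast_sub, Int.cast_natCast, Int.cast_one] using this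
  · have := mem_blockArc_intCast (N := N) (L := L₂) j (2 * b + 1 - (L₂ - 1)) (by linarith)
      (by linarith)
    simpa only [posY, intSite, dbl_intCast, Int.cast_sub, Int.cast_natCast, Int.cast_one,
      Int.cast_add] using this

theorem intSite_add_X (a b : ℤ) :
    intSite (N := N) (L₁ := L₁) (L₂ := L₂) a b + (1, 0) = intSite (a + 1) b := by
  simp [intSite]

theorem intSite_add_Y (a b : ℤ) :
    intSite (N := N) (L₁ := L₁) (L₂ := L₂) a b + (0, 1) = intSite a (b + 1) := by
  simp [intSite]

theorem exists_coord {L : ℕ} (i : ℤ) (x : ZMod (N * L))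
    (hx : dbl N L x - (L - 1) ∈ blockArc N L (i : ZMod N)) :
    ∃ a : ℤ, (a : ZMod (N * L)) = x ∧ 2 * L * i + (L - 1) ≤ 2 * a ∧
      2 * a ≤ 2 * L * i + (L - 1) + 2 * L := by
  obtain ⟨z, h1, h2, h3⟩ := exists_lift_of_mem_blockArc i _ hx
  obtain ⟨a, ha, rfl⟩ := exists_half_of_dbl_eq x (z + (L - 1)) (by
    push_cast
    rw [h3]
    ring)
  exact ⟨a, rfl, by linarith, by linarith⟩

theorem exists_coord_bond {L : ℕ} (i : ℤ) (x : ZMod (N * L))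
    (hx : dbl N L x + 1 - (L - 1) ∈ blockArc N L (i : ZMod N)) :
    ∃ a : ℤ, (a : ZMod (N * L)) = x ∧ 2 * L * i + (L - 1) ≤ 2 * a + 1 ∧
      2 * a + 1 ≤ 2 * L * i + (L - 1) + 2 * L := by
  obtain ⟨z, h1, h2, h3⟩ := exists_lift_of_mem_blockArc i _ hx
  obtain ⟨a, ha, rfl⟩ := exists_half_of_dbl_eq x (z + (L - 1) - 1) (by
    push_cast
    rw [h3]
    ring)
  exact ⟨a, rfl, by linarith, by linarith⟩

theorem exists_blockArc {L : ℕ} [NeZero L] (x : Circ N L) : ∃ b, x ∈ blockArc N L b := by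
  obtain ⟨z, rfl⟩ := ZMod.intCast_surjective x
  have hL : (0 : ℤ) < 2 * L := by
    have := NeZero.pos L
    positivity
  exact ⟨_, mem_blockArc_intCast (z / (2 * L)) z (Int.mul_ediv_self_le hL.ne')
    (Int.lt_mul_ediv_self_add hL |>.le.trans (by linarith))⟩

end

/-! ### Overlap and connectedness of blocks -/

section
variable {N L₁ L₂ : ℕ}

/-- The common side sits at an integer doubled coordinate: if it is even the side contains sites, if
odd, midpoints of horizontal bonds. -/
theorem block_inter_X [NeZero L₂] (i j : ZMod N) :
    ∃ p : Deco N L₁ L₂, p ∈ block (i, j) ∧ p ∈ block (i + 1, j) := by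
  obtain ⟨i, rfl⟩ := ZMod.intCast_surjective i
  obtain ⟨j, rfl⟩ := ZMod.intCast_surjective j
  have hL2 : (1 : ℤ) ≤ L₂ := by exact_mod_cast NeZero.pos L₂
  have hi : (i : ZMod N) + 1 = ((i + 1 : ℤ) : ZMod N) := by push_cast; rfl
  have e1 : 2 * (L₁ : ℤ) * (i + 1) = 2 * L₁ * i + 2 * L₁ := by ring
  have e2 : 2 * ((L₂ : ℤ) * j + L₂ - 1) = 2 * L₂ * j + (L₂ - 1) + (L₂ - 1) := by ring
  rw [hi]
  obtain ⟨w, hw | hw⟩ := Int.even_or_odd' (2 * L₁ * i + (L₁ - 1) + 2 * L₁)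
  · exact ⟨.inl (intSite w (L₂ * j + L₂ - 1)),
      mem_block_site i j _ _ (by omega) (by omega) (by omega) (by omega),
      mem_block_site (i + 1) j _ _ (by omega) (by omega) (by omega) (by omega)⟩
  · exact ⟨.inr (.inl (intSite w (L₂ * j + L₂ - 1))),
      mem_block_hbond i j _ _ (by omega) (by omega) (by omega) (by omega),
      mem_block_hbond (i + 1) j _ _ (by omega) (by omega) (by omega) (by omega)⟩

theorem block_inter_Y [NeZero L₁] (i j : ZMod N) :
    ∃ p : Deco N L₁ L₂, p ∈ block (i, j) ∧ p ∈ block (i, j + 1) := by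
  obtain ⟨i, rfl⟩ := ZMod.intCast_surjective i
  obtain ⟨j, rfl⟩ := ZMod.intCast_surjective j
  have hL1 : (1 : ℤ) ≤ L₁ := by exact_mod_cast NeZero.pos L₁
  have hj : (j : ZMod N) + 1 = ((j + 1 : ℤ) : ZMod N) := by push_cast; rfl
  have e1 : 2 * (L₂ : ℤ) * (j + 1) = 2 * L₂ * j + 2 * L₂ := by ring
  have e2 : 2 * ((L₁ : ℤ) * i + L₁ - 1) = 2 * L₁ * i + (L₁ - 1) + (L₁ - 1) := by ring
  rw [hj]
  obtain ⟨w, hw | hw⟩ := Int.even_or_odd' (2 * L₂ * j + (L₂ - 1) + 2 * L₂)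
  · exact ⟨.inl (intSite (L₁ * i + L₁ - 1) w),
      mem_block_site i j _ _ (by omega) (by omega) (by omega) (by omega),
      mem_block_site i (j + 1) _ _ (by omega) (by omega) (by omega) (by omega)⟩
  · exact ⟨.inr (.inr (intSite (L₁ * i + L₁ - 1) w)),
      mem_block_vbond i j _ _ (by omega) (by omega) (by omega) (by omega),
      mem_block_vbond i (j + 1) _ _ (by omega) (by omega) (by omega) (by omega)⟩

/-- A block without frustrated half-bonds is not mixed. -/
theorem block_const [NeZero L₁] [NeZero L₂] (b : ZMod N × ZMod N) (η : Deco N L₁ L₂ → ℤˣ)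
    (h : ∀ e : HalfBond N L₁ L₂, halfSrc e ∈ block b → halfTgt e ∈ block b →
      η (halfSrc e) = η (halfTgt e)) : ¬ Mixed (block b) η := by
  obtain ⟨i, j⟩ := b
  obtain ⟨i, rfl⟩ := ZMod.intCast_surjective i
  obtain ⟨j, rfl⟩ := ZMod.intCast_surjective j
  have hL1 : (1 : ℤ) ≤ L₁ := by exact_mod_cast NeZero.pos L₁
  have hL2 : (1 : ℤ) ≤ L₂ := by exact_mod_cast NeZero.pos L₂
  set lo₁ : ℤ := 2 * L₁ * i + (L₁ - 1) with hlo₁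
  set lo₂ : ℤ := 2 * L₂ * j + (L₂ - 1) with hlo₂
  have hHs : ∀ a b : ℤ, lo₁ ≤ 2 * a → 2 * a + 1 ≤ lo₁ + 2 * L₁ → lo₂ ≤ 2 * b →
      2 * b ≤ lo₂ + 2 * L₂ → η (.inl (intSite a b)) = η (.inr (.inl (intSite a b))) :=
    fun a b h1 h2 h3 h4 => h (intSite a b, false, false)
      (mem_block_site i j a b h1 (by omega) h3 h4)
      (mem_block_hbond i j a b (by omega) h2 h3 h4)
  have hHt : ∀ a b : ℤ, lo₁ ≤ 2 * a + 1 → 2 * (a + 1) ≤ lo₁ + 2 * L₁ → lo₂ ≤ 2 * b →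
      2 * b ≤ lo₂ + 2 * L₂ → η (.inl (intSite (a + 1) b)) = η (.inr (.inl (intSite a b))) := by
    intro a b h1 h2 h3 h4
    rw [← intSite_add_X]
    refine h (intSite a b, false, true) ?_ (mem_block_hbond i j a b h1 (by omega) h3 h4)
    simp only [halfSrc, intSite_add_X]
    exact mem_block_site i j (a + 1) b (by omega) h2 h3 h4
  have hVs : ∀ a b : ℤ, lo₁ ≤ 2 * a → 2 * a ≤ lo₁ + 2 * L₁ → lo₂ ≤ 2 * b →
      2 * b + 1 ≤ lo₂ + 2 * L₂ → η (.inl (intSite a b)) = η (.inr (.inr (intSite a b))) :=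
    fun a b h1 h2 h3 h4 => h (intSite a b, true, false)
      (mem_block_site i j a b h1 h2 h3 (by omega))
      (mem_block_vbond i j a b h1 h2 (by omega) h4)
  have hVt : ∀ a b : ℤ, lo₁ ≤ 2 * a → 2 * a ≤ lo₁ + 2 * L₁ → lo₂ ≤ 2 * b + 1 →
      2 * (b + 1) ≤ lo₂ + 2 * L₂ →
      η (.inl (intSite a (b + 1))) = η (.inr (.inr (intSite a b))) := by
    intro a b h1 h2 h3 h4
    rw [← intSite_add_Y]
    refine h (intSite a b, true, true) ?_ (mem_block_vbond i j a b h1 h2 h3 (by omega))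
    simp only [halfSrc, intSite_add_Y]
    exact mem_block_site i j a (b + 1) h1 h2 (by omega) h4
  -- The last site of cell `(i, j)` lies in the block for all side lengths and serves as base point.
  set a₀ : ℤ := L₁ * i + L₁ - 1 with ha₀
  set b₀ : ℤ := L₂ * j + L₂ - 1 with hb₀
  have ha1 : 2 * a₀ = lo₁ + (L₁ - 1) := by rw [ha₀, hlo₁]; ring
  have hb1 : 2 * b₀ = lo₂ + (L₂ - 1) := by rw [hb₀, hlo₂]; ring
  have hsite : ∀ a b : ℤ, lo₁ ≤ 2 * a → 2 * a ≤ lo₁ + 2 * L₁ → lo₂ ≤ 2 * b →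
      2 * b ≤ lo₂ + 2 * L₂ → η (.inl (intSite a b)) = η (.inl (intSite a₀ b₀)) := by
    intro a b h1 h2 h3 h4
    refine (eq_of_step (fun a => η (.inl (intSite a b))) lo₁ (lo₁ + 2 * L₁) (fun a h5 h6 => ?_)
      a a₀ h1 h2 (by omega) (by omega)).trans
      (eq_of_step (fun b => η (.inl (intSite a₀ b))) lo₂ (lo₂ + 2 * L₂) (fun b h5 h6 => ?_)
      b b₀ h3 h4 (by omega) (by omega))
    · exact (hHs a b h5 (by omega) h3 h4).trans (hHt a b (by omega) h6 h3 h4).symm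
    · exact (hVs a₀ b (by omega) (by omega) h5 (by omega)).trans
        (hVt a₀ b (by omega) (by omega) (by omega) h6).symm
  have hall : ∀ p ∈ block ((i : ZMod N), (j : ZMod N)), η p = η (.inl (intSite a₀ b₀)) := by
    rintro (⟨x, y⟩ | ⟨x, y⟩ | ⟨x, y⟩) ⟨hx, hy⟩
    · obtain ⟨a, rfl, h1, h2⟩ := exists_coord i x hx
      obtain ⟨b, rfl, h3, h4⟩ := exists_coord j y hy
      exact hsite a b h1 h2 h3 h4
    · obtain ⟨a, rfl, h1, h2⟩ := exists_coord_bond i x hx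
      obtain ⟨b, rfl, h3, h4⟩ := exists_coord j y hy
      -- A bond whose midpoint lies on the side of the block has only one end inside; the midpoint
      -- is compared with an end that is.
      rcases le_or_gt lo₁ (2 * a) with h5 | h5
      · exact (hHs a b h5 h2 h3 h4).symm.trans (hsite a b h5 (by omega) h3 h4)
      · exact (hHt a b h1 (by omega) h3 h4).symm.trans (hsite (a + 1) b (by omega) (by omega) h3 h4)
    · obtain ⟨a, rfl, h1, h2⟩ := exists_coord i x hx
      obtain ⟨b, rfl, h3, h4⟩ := exists_coord_bond j y hy
      rcases le_or_gt lo₂ (2 * b) with h5 | h5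
      · exact (hVs a b h1 h2 h5 h4).symm.trans (hsite a b h1 h2 h5 (by omega))
      · exact (hVt a b h1 h2 h3 (by omega)).symm.trans
          (hsite a (b + 1) h1 h2 (by omega) (by omega))
  rintro ⟨p, hp, q, hq, hpq⟩
  exact hpq ((hall p hp).trans (hall q hq).symm)

theorem exists_block [NeZero L₁] [NeZero L₂] (p : Deco N L₁ L₂) : ∃ b, p ∈ block b := by
  obtain ⟨i, hi⟩ := exists_blockArc (posX p)
  obtain ⟨j, hj⟩ := exists_blockArc (posY p)
  exact ⟨(i, j), hi, hj⟩

end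

/-! ### The Peierls bound when every block is mixed -/

section
variable {N L₁ L₂ : ℕ} [NeZero N] [NeZero L₁] [NeZero L₂]

/-- Each mixed block contains a frustrated half-bond, and the source of a half-bond lies in at most
two blocks per direction, hence in at most four. -/
theorem card_le_frustrated (η : Deco N L₁ L₂ → ℤˣ)
    (h : ∀ b : ZMod N × ZMod N, Mixed (block b) η) : N ^ 2 ≤ 4 * (frustrated η).card := by
  classical
  have h1 : ∀ b : ZMod N × ZMod N, ∃ e ∈ frustrated η, halfSrc e ∈ block b := by
    intro b
    by_contra hb
    push Not at hb
    refine block_const b η (fun e hs _ => ?_) (h b)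
    by_contra hne
    exact hb e (by simp [frustrated, hne]) hs
  choose g hg hg' using h1
  have h2 := Finset.card_le_mul_card_image_of_maps_to (f := g) (s := Finset.univ)
    (t := frustrated η) (fun b _ => hg b) 4 (by
      intro e _
      obtain ⟨i, i', hi⟩ := exists_two_blocks (posX (halfSrc e))
      obtain ⟨j, j', hj⟩ := exists_two_blocks (posY (halfSrc e))
      have hsub : (Finset.univ.filter fun b => g b = e) ⊆
          ({i, i'} : Finset (ZMod N)) ×ˢ ({j, j'} : Finset (ZMod N)) := by
        intro b hb
        simp only [Finset.mem_filter, Finset.mem_univ, true_and] at hb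
        have hb' := hg' b
        rw [hb] at hb'
        simp only [Finset.mem_product, Finset.mem_insert, Finset.mem_singleton]
        exact ⟨hi _ hb'.1, hj _ hb'.2⟩
      refine (Finset.card_le_card hsub).trans ?_
      rw [Finset.card_product]
      exact Nat.mul_le_mul Finset.card_le_two Finset.card_le_two)
  simpa [Finset.card_univ, ZMod.card, sq] using h2

theorem card_halfBond : Fintype.card (HalfBond N L₁ L₂) = 4 * (L₁ * L₂) * N ^ 2 := by
  simp only [Fintype.card_prod, ZMod.card, Fintype.card_bool]
  ring

theorem le_decoWeight_empty (hN : Even N) (κ h β : ℝ) :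
    Real.exp (κ * Fintype.card (HalfBond N L₁ L₂)) ≤
      decoWeight (N := N) (L₁ := L₁) (L₂ := L₂) κ h β ∅ := by
  classical
  rw [← decoExponent_one hN κ h β]
  unfold decoWeight mixedWeight
  simp only [Set.mem_empty_iff_false, false_imp_iff, implies_true, if_true]
  exact Finset.single_le_sum
    (f := fun η => Real.exp (isingExponent halfSrc halfTgt κ (decoField h β) η))
    (fun η _ => (Real.exp_pos _).le) (Finset.mem_univ (fun _ : Deco N L₁ L₂ => (1 : ℤˣ)))

/-- The weight of the configurations that are mixed everywhere. -/
theorem decoWeight_univ_le (hN : Even N) (J κ h β : ℝ) (hh : 0 < h) (hβ : 0 < β)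
    (hκ : β * J ≤ κ) (hP : 0 < peierlsConst L₁ L₂ J h)
    (hx : 4 * ((L₁ : ℝ) * L₂) * Real.exp (-(β / 2) * peierlsConst L₁ L₂ J h) ≤ 1) :
    decoWeight (N := N) (L₁ := L₁) (L₂ := L₂) κ h β Set.univ ≤
      (6 * Real.exp (-(β / 8) * peierlsConst L₁ L₂ J h)) ^ (N ^ 2) *
        decoWeight (N := N) (L₁ := L₁) (L₂ := L₂) κ h β ∅ := by
  classical
  set P := peierlsConst L₁ L₂ J h with hPdef
  set x := Real.exp (-(β / 2) * P) with hxdef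
  set y := Real.exp (-(β / 8) * P) with hydef
  set C := Real.exp (κ * Fintype.card (HalfBond N L₁ L₂)) with hC
  have hx0 : 0 < x := Real.exp_pos _
  have hC0 : 0 < C := Real.exp_pos _
  have hy0 : 0 < y := Real.exp_pos _
  -- Half of the cost `β * P` per frustrated half-bond is kept as `x`; the other half, over at least
  -- `N ^ 2 / 4` of them, becomes `y ^ (N ^ 2)`.
  have h1 : decoWeight (N := N) (L₁ := L₁) (L₂ := L₂) κ h β Set.univ ≤
      ∑ η : Deco N L₁ L₂ → ℤˣ, C * y ^ (N ^ 2) * x ^ (frustrated η).card := by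
    refine Finset.sum_le_sum fun η _ => ?_
    split_ifs with hm
    · have h2 := decoExponent_le hN J κ h β hh hβ hκ η
      have h3 : ((N ^ 2 : ℕ) : ℝ) ≤ 4 * (frustrated η).card := by
        exact_mod_cast card_le_frustrated η fun b => hm b (Set.mem_univ b)
      rw [hC, hydef, hxdef, ← Real.exp_nat_mul, ← Real.exp_nat_mul, ← Real.exp_add,
        ← Real.exp_add]
      refine Real.exp_le_exp.2 (h2.trans ?_)
      have h4 := mul_le_mul_of_nonneg_left h3 (mul_pos hβ hP).le
      rw [← hPdef]
      linarith
    · positivity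
  refine h1.trans ?_
  rw [← Finset.mul_sum]
  have h2 : (1 + x) ^ Fintype.card (HalfBond N L₁ L₂) ≤ 3 ^ (N ^ 2) := by
    rw [card_halfBond, pow_mul]
    refine pow_le_pow_left₀ (by positivity) ?_ _
    calc (1 + x) ^ (4 * (L₁ * L₂)) ≤ Real.exp x ^ (4 * (L₁ * L₂)) :=
          pow_le_pow_left₀ (by positivity) (by linarith [Real.add_one_le_exp x]) _
      _ = Real.exp (4 * ((L₁ : ℝ) * L₂) * x) := by
          rw [← Real.exp_nat_mul]; push_cast; rfl
      _ ≤ Real.exp 1 := Real.exp_le_exp.2 hx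
      _ ≤ 3 := Real.exp_one_lt_three.le
  -- The global sign contributes a factor 2, absorbed block by block; together with the `3` above it
  -- gives the constant 6.
  have h3 : (2 : ℝ) ≤ 2 ^ (N ^ 2) := by
    have : 1 ≤ N ^ 2 := Nat.one_le_pow _ _ (NeZero.pos N)
    simpa using pow_le_pow_right₀ (one_le_two : (1 : ℝ) ≤ 2) this
  calc C * y ^ (N ^ 2) * ∑ η : Deco N L₁ L₂ → ℤˣ, x ^ (frustrated η).card
      ≤ C * y ^ (N ^ 2) * (2 ^ (N ^ 2) * 3 ^ (N ^ 2)) := by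
        refine mul_le_mul_of_nonneg_left ((sum_pow_frustrated_le x hx0.le).trans ?_)
          (by positivity)
        exact mul_le_mul h3 h2 (by positivity) (by positivity)
    _ = (6 * y) ^ (N ^ 2) * C := by
        rw [← mul_pow, mul_pow 6 y]
        norm_num
        ring
    _ ≤ _ := mul_le_mul_of_nonneg_left (le_decoWeight_empty hN κ h β) (by positivity)

end

/-! ### Closed walks through a cluster -/

/-- A connected set of at least `m + 1` vertices contains a closed walk of `2 m` steps that visits
`m + 1` vertices. -/
theorem exists_closed_walk {V : Type*} [Finite V] [DecidableEq V] (H : SimpleGraph V) (v : V)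
    (m : ℕ) (hm : m + 1 ≤ {y | H.Reachable v y}.ncard) :
    ∃ p : H.Walk v v, p.length = 2 * m ∧ p.support.toFinset.card = m + 1 := by
  induction m with
  | zero => exact ⟨.nil, rfl, by simp⟩
  | succ m ih =>
    obtain ⟨p, hlen, hcard⟩ := ih (by omega)
    obtain ⟨y, hy, hyp⟩ : ∃ y ∈ {y | H.Reachable v y}, y ∉ (p.support.toFinset : Set V) := by
      refine Set.exists_mem_notMem_of_ncard_lt_ncard ?_ (Set.toFinite _)
      rw [Set.ncard_coe_finset, hcard]
      omega
    obtain ⟨q⟩ := hy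
    obtain ⟨d, -, hd1, hd2⟩ := q.exists_boundary_dart (p.support.toFinset : Set V) (by simp) hyp
    have hd1' : d.toProd.1 ∈ p.support := by simpa using hd1
    have hd2' : d.toProd.2 ∉ p.support := by simpa using hd2
    have hspec := p.take_spec hd1'
    -- Insert a there-and-back step to a new neighbour at its first contact with the walk.
    refine ⟨(p.takeUntil _ hd1').append
      (.cons d.adj (.cons d.adj.symm (p.dropUntil _ hd1'))), ?_, ?_⟩
    · have := congrArg SimpleGraph.Walk.length hspec
      simp only [SimpleGraph.Walk.length_append, SimpleGraph.Walk.length_cons] at this ⊢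
      omega
    · rw [← hcard]
      have hins : ((p.takeUntil _ hd1').append
          (.cons d.adj (.cons d.adj.symm (p.dropUntil _ hd1')))).support.toFinset =
          insert d.toProd.2 p.support.toFinset := by
        ext z
        have hz : z ∈ p.support ↔
            z ∈ (p.takeUntil _ hd1').support ∨ z ∈ (p.dropUntil _ hd1').support := by
          rw [← SimpleGraph.Walk.mem_support_append_iff, hspec]
        have hs : z = d.toProd.1 → z ∈ (p.dropUntil _ hd1').support := by
          rintro rfl
          exact SimpleGraph.Walk.start_mem_support _
        simp only [List.mem_toFinset, SimpleGraph.Walk.mem_support_append_iff,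
          SimpleGraph.Walk.support_cons, List.mem_cons, Finset.mem_insert, hz]
        tauto
      rw [hins, Finset.card_insert_of_notMem (by simpa using hd2')]

/-! ### King walks and bad clusters -/

section King
variable {N : ℕ}

/-- The displacements of a king, including the trivial one. -/
def kingSteps (N : ℕ) : Finset (ZMod N × ZMod N) :=
  ({0, 1, -1} : Finset (ZMod N)) ×ˢ ({0, 1, -1} : Finset (ZMod N))

theorem card_kingSteps_le : (kingSteps N).card ≤ 9 := by
  rw [kingSteps, Finset.card_product]
  exact Nat.mul_le_mul Finset.card_le_three Finset.card_le_three

theorem neg_mem_kingSteps {d : ZMod N × ZMod N} (hd : d ∈ kingSteps N) : -d ∈ kingSteps N := by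
  simp only [kingSteps, Finset.mem_product, Finset.mem_insert, Finset.mem_singleton,
    Prod.fst_neg, Prod.snd_neg, neg_eq_zero, neg_inj] at hd ⊢
  refine ⟨?_, ?_⟩
  · rcases hd.1 with h | h | h <;> simp [h]
  · rcases hd.2 with h | h | h <;> simp [h]

/-- The graph of king moves between bad vertices. -/
def badGraph (Bad : Set (ZMod N × ZMod N)) : SimpleGraph (ZMod N × ZMod N) where
  Adj b c := b ≠ c ∧ c - b ∈ kingSteps N ∧ b ∈ Bad ∧ c ∈ Bad
  symm := ⟨fun b c h => ⟨h.1.symm, by simpa using neg_mem_kingSteps h.2.1, h.2.2.2, h.2.2.1⟩⟩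
  loopless := ⟨fun b h => h.1 rfl⟩

/-- The bad cluster of a vertex. -/
def cluster (Bad : Set (ZMod N × ZMod N)) (v : ZMod N × ZMod N) : Set (ZMod N × ZMod N) :=
  {y | (badGraph Bad).Reachable v y}

theorem mem_bad_of_mem_support {Bad : Set (ZMod N × ZMod N)} {v w : ZMod N × ZMod N}
    (p : (badGraph Bad).Walk v w) (hv : v ∈ Bad) : ∀ x ∈ p.support, x ∈ Bad := by
  induction p with
  | nil => simpa using hv
  | cons h p ih =>
    intro x hx
    rcases List.mem_cons.1 (SimpleGraph.Walk.support_cons h p ▸ hx) with rfl | hx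
    · exact hv
    · exact ih h.2.2.2 x hx

/-- The supports of the king walks with `n` steps that start at `v`. -/
def walkSupports : ℕ → ZMod N × ZMod N → Finset (Finset (ZMod N × ZMod N))
  | 0, v => {{v}}
  | n + 1, v => (kingSteps N).biUnion fun d => (walkSupports n (v + d)).image (insert v)

theorem card_walkSupports_le (n : ℕ) (v : ZMod N × ZMod N) :
    (walkSupports n v).card ≤ 9 ^ n := by
  induction n generalizing v with
  | zero => simp [walkSupports]
  | succ n ih =>
    rw [walkSupports, pow_succ']
    refine (Finset.card_biUnion_le_card_mul _ _ (9 ^ n) fun d _ =>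
      Finset.card_image_le.trans (ih _)).trans ?_
    exact Nat.mul_le_mul_right _ card_kingSteps_le

/-- The graph depends on the configuration, the family of possible supports does not; a union bound
over it is therefore possible. -/
theorem support_mem_walkSupports {Bad : Set (ZMod N × ZMod N)} {v w : ZMod N × ZMod N}
    (p : (badGraph Bad).Walk v w) : p.support.toFinset ∈ walkSupports p.length v := by
  induction p with
  | nil => simp [walkSupports]
  | @cons u v w h p ih =>
    rw [SimpleGraph.Walk.length_cons, walkSupports, Finset.mem_biUnion]
    refine ⟨v - u, h.2.1, Finset.mem_image.2 ⟨p.support.toFinset, ?_, ?_⟩⟩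
    · rwa [add_sub_cancel]
    · rw [SimpleGraph.Walk.support_cons, List.toFinset_cons]

end King

/-! ### Finite weights -/

open Classical in
/-- The weight of an event. -/
def weightOf {Ω : Type*} [Fintype Ω] (w : Ω → ℝ) (E : Ω → Prop) : ℝ :=
  ∑ ω, if E ω then w ω else 0

section Weight
variable {Ω : Type*} [Fintype Ω] {w : Ω → ℝ}

theorem weightOf_mono (hw : ∀ ω, 0 ≤ w ω) {E F : Ω → Prop} (h : ∀ ω, E ω → F ω) :
    weightOf w E ≤ weightOf w F := by
  refine Finset.sum_le_sum fun ω _ => ?_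
  by_cases hE : E ω
  · rw [if_pos hE, if_pos (h ω hE)]
  · rw [if_neg hE]
    split_ifs
    · exact hw ω
    · exact le_rfl

theorem weightOf_or_le (hw : ∀ ω, 0 ≤ w ω) (E F : Ω → Prop) :
    weightOf w (fun ω => E ω ∨ F ω) ≤ weightOf w E + weightOf w F := by
  unfold weightOf
  rw [← Finset.sum_add_distrib]
  refine Finset.sum_le_sum fun ω _ => ?_
  have := hw ω
  by_cases hE : E ω <;> by_cases hF : F ω <;> simp [hE, hF, this]

theorem weightOf_exists_le (hw : ∀ ω, 0 ≤ w ω) {ι : Type*} (s : Finset ι) (E : ι → Ω → Prop) :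
    weightOf w (fun ω => ∃ i ∈ s, E i ω) ≤ ∑ i ∈ s, weightOf w (E i) := by
  unfold weightOf
  rw [Finset.sum_comm]
  refine Finset.sum_le_sum fun ω _ => ?_
  have h0 : ∀ i ∈ s, (0 : ℝ) ≤ @ite ℝ (E i ω) (Classical.propDecidable _) (w ω) 0 := by
    intro i _
    split_ifs
    · exact hw ω
    · exact le_rfl
  split_ifs with h
  · obtain ⟨i, hi, hE⟩ := h
    refine le_trans ?_ (Finset.single_le_sum h0 hi)
    rw [if_pos hE]
  · exact Finset.sum_nonneg h0

/-- A cluster with at least `m + 1` vertices contains the support of a closed walk of `2 * m` steps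
with exactly `m + 1` vertices, all bad; there are at most `9 ^ (2 * m) = 81 ^ m` such supports. -/
theorem weightOf_cluster_le {N : ℕ} [NeZero N] (hw : ∀ ω, 0 ≤ w ω)
    (Bad : Ω → Set (ZMod N × ZMod N)) (ε Z : ℝ) (hε : 0 ≤ ε) (hZ : 0 ≤ Z)
    (hB : ∀ B : Finset (ZMod N × ZMod N), weightOf w (fun ω => ∀ b ∈ B, b ∈ Bad ω) ≤
      ε ^ B.card * Z) (v : ZMod N × ZMod N) (m : ℕ) :
    weightOf w (fun ω => v ∈ Bad ω ∧ m + 1 ≤ (cluster (Bad ω) v).ncard) ≤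
      (81 * ε) ^ (m + 1) * Z := by
  classical
  have h1 : ∀ ω, (v ∈ Bad ω ∧ m + 1 ≤ (cluster (Bad ω) v).ncard) →
      ∃ B ∈ (walkSupports (2 * m) v).filter (fun B => B.card = m + 1), ∀ b ∈ B, b ∈ Bad ω := by
    rintro ω ⟨hv, hm⟩
    obtain ⟨p, hp, hc⟩ := exists_closed_walk (badGraph (Bad ω)) v m hm
    refine ⟨p.support.toFinset, Finset.mem_filter.2 ⟨hp ▸ support_mem_walkSupports p, hc⟩, ?_⟩
    intro b hb
    exact mem_bad_of_mem_support p hv b (by simpa using hb)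
  refine (weightOf_mono hw h1).trans ((weightOf_exists_le hw _ _).trans ?_)
  refine (Finset.sum_le_card_nsmul _ _ (ε ^ (m + 1) * Z) fun B hBm => ?_).trans ?_
  · have := hB B
    rwa [(Finset.mem_filter.1 hBm).2] at this
  · rw [nsmul_eq_mul, mul_pow, mul_assoc]
    refine mul_le_mul_of_nonneg_right ?_ (by positivity)
    have h2 : (((walkSupports (2 * m) v).filter fun B => B.card = m + 1).card : ℝ) ≤ 9 ^ (2 * m) := by
      exact_mod_cast (Finset.card_filter_le _ _).trans (card_walkSupports_le _ _)
    refine h2.trans ?_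
    rw [pow_mul]
    norm_num
    exact pow_le_pow_right₀ (by norm_num) (Nat.le_succ m)

end Weight

/-! ### Potentials of closed bond sets on the torus -/

/-- Pigeonhole: the shifts by `0, …, S.card` are distinct modulo `N`. -/
theorem exists_missed_shift {N : ℕ} (S : Finset (ZMod N)) (hS : S.card < N) (x : ZMod N) :
    ∃ r : ℕ, r ≤ S.card ∧ x + r ∉ S := by
  by_contra hcon
  push Not at hcon
  have h1 : ((Finset.range (S.card + 1)).image fun r : ℕ => x + (r : ZMod N)) ⊆ S := by
    intro y hy
    obtain ⟨r, hr, rfl⟩ := Finset.mem_image.1 hy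
    exact hcon r (by simpa [Nat.lt_succ_iff] using hr)
  have h2 := Finset.card_le_card h1
  rw [Finset.card_image_of_injOn, Finset.card_range] at h2
  · omega
  · intro a ha b hb hab
    simp only [Finset.coe_range, Set.mem_Iio] at ha hb
    have h3 : (a : ZMod N) = b := add_left_cancel hab
    have := congrArg ZMod.val h3
    rwa [ZMod.val_cast_of_lt (by omega), ZMod.val_cast_of_lt (by omega)] at this

section Potential
variable {N : ℕ} [NeZero N]

theorem zmod_two_eq_iff (a b : ZMod 2) : a + b = 0 ↔ a = b := by
  revert a b
  decide

theorem sum_range_zmod {M : Type*} [AddCommMonoid M] (f : ZMod N → M) :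
    ∑ r ∈ Finset.range N, f (r : ZMod N) = ∑ x, f x := by
  refine Finset.sum_nbij' (fun r => (r : ZMod N)) (fun x => x.val) ?_ ?_ ?_ ?_ ?_
  · intro r _
    exact Finset.mem_univ _
  · intro x _
    exact Finset.mem_range.2 (ZMod.val_lt x)
  · intro r hr
    exact ZMod.val_cast_of_lt (Finset.mem_range.1 hr)
  · intro x _
    exact ZMod.natCast_zmod_val x
  · intro r _
    rfl

/-- A closed set of dual bonds, supported near a set `D` with fewer than `N` vertices, is the
coboundary of a function that is constant away from `D`. -/
theorem exists_potential (h v : ZMod N × ZMod N → ZMod 2)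
    (hclosed : ∀ b, h b + v (b + (1, 0)) + h (b + (0, 1)) + v b = 0)
    (D : Finset (ZMod N × ZMod N)) (hD : D.card < N)
    (hh : ∀ b, h b ≠ 0 → b ∈ D ∨ b + (1, 0) ∈ D) (hv : ∀ b, v b ≠ 0 → b ∈ D ∨ b + (0, 1) ∈ D) :
    ∃ g : ZMod N × ZMod N → ZMod 2, (∀ b, g b + g (b + (1, 0)) = h b) ∧
      (∀ b, g b + g (b + (0, 1)) = v b) ∧
      ∃ g₀, ∀ s, (∀ r : ℕ, r ≤ D.card → s + ((r : ZMod N), 0) ∉ D) → g s = g₀ := by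
  classical
  have two : (2 : ZMod 2) = 0 := by decide
  have hcols : (D.image Prod.fst).card < N := Finset.card_image_le.trans_lt hD
  have hrows : (D.image Prod.snd).card < N := Finset.card_image_le.trans_lt hD
  -- A column `x₀` and a row `y₀` that avoid `D`; the cochain vanishes along both.
  obtain ⟨rx, -, hrx⟩ := exists_missed_shift _ hcols 0
  obtain ⟨ry, -, hry⟩ := exists_missed_shift _ hrows 0
  set x₀ : ZMod N := 0 + rx
  set y₀ : ZMod N := 0 + ry
  clear_value x₀ y₀
  have hcol : ∀ x, x ∉ D.image Prod.fst → ∀ y, v (x, y) = 0 := by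
    intro x hx y
    by_contra hne
    rcases hv _ hne with hm | hm
    · exact hx (Finset.mem_image.2 ⟨_, hm, rfl⟩)
    · exact hx (Finset.mem_image.2 ⟨_, hm, by simp⟩)
  have hrow : ∀ x, h (x, y₀) = 0 := by
    intro x
    by_contra hne
    rcases hh _ hne with hm | hm
    · exact hry (Finset.mem_image.2 ⟨_, hm, rfl⟩)
    · exact hry (Finset.mem_image.2 ⟨_, hm, by simp⟩)
  have hcl : ∀ x y, h (x, y) + v (x + 1, y) + h (x, y + 1) + v (x, y) = 0 := by
    intro x y
    simpa using hclosed (x, y)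
  -- By closedness the holonomy around a row does not depend on the row, and it vanishes on row
  -- `y₀`; so the potential below is single-valued.
  have hrowsum : ∀ y, ∑ x, h (x, y) = 0 := by
    intro y
    have h1 : ∀ y, ∑ x, h (x, y) = ∑ x, h (x, y + 1) := by
      intro y
      have h2 : ∑ x, v (x + 1, y) = ∑ x, v (x, y) :=
        Equiv.sum_comp (Equiv.addRight (1 : ZMod N)) fun x => v (x, y)
      have h3 : ∑ x, (h (x, y) + v (x + 1, y) + h (x, y + 1) + v (x, y)) = 0 :=
        Finset.sum_eq_zero fun x _ => hcl x y
      simp only [Finset.sum_add_distrib] at h3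
      rw [← zmod_two_eq_iff]
      rw [h2] at h3
      linear_combination h3 - (∑ x, v (x, y)) * two
    rw [eq_of_add_one_eq (fun y => ∑ x, h (x, y)) h1 y y₀]
    exact Finset.sum_eq_zero fun x _ => hrow x
  set g : ZMod N × ZMod N → ZMod 2 := fun b =>
    ∑ r ∈ Finset.range (b.1 - x₀).val, h (x₀ + r, b.2) with hg
  have hgX : ∀ b, g b + g (b + (1, 0)) = h b := by
    rintro ⟨x, y⟩
    simp only [hg, Prod.mk_add_mk, add_zero]
    have hx : x + 1 - x₀ = (x - x₀) + 1 := by ring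
    rw [hx]
    set j := x - x₀ with hj
    have hjx : x₀ + (j.val : ZMod N) = x := by rw [ZMod.natCast_zmod_val, hj]; ring
    have hj1 : j + 1 = ((j.val + 1 : ℕ) : ZMod N) := by simp
    have hlt := ZMod.val_lt j
    rcases Nat.lt_or_ge (j.val + 1) N with hc | hc
    · rw [hj1, ZMod.val_cast_of_lt hc, Finset.sum_range_succ, hjx]
      linear_combination (∑ r ∈ Finset.range j.val, h (x₀ + r, y)) * two
    · have hN : j.val + 1 = N := by omega
      have hs : ∑ r ∈ Finset.range (j.val + 1), h (x₀ + (r : ZMod N), y) = 0 := by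
        rw [hN, sum_range_zmod fun r => h (x₀ + r, y)]
        rw [← hrowsum y]
        exact Equiv.sum_comp (Equiv.addLeft x₀) fun x => h (x, y)
      rw [Finset.sum_range_succ, hjx] at hs
      rw [hj1, hN, ZMod.natCast_self, ZMod.val_zero, Finset.sum_range_zero, add_zero]
      exact (zmod_two_eq_iff _ _).1 hs
  have hgY : ∀ b, g b + g (b + (0, 1)) = v b := by
    rintro ⟨x, y⟩
    simp only [hg, Prod.mk_add_mk, add_zero]
    have key : ∀ n : ℕ, ∑ r ∈ Finset.range n, h (x₀ + r, y) +
        ∑ r ∈ Finset.range n, h (x₀ + r, y + 1) = v (x₀ + n, y) := by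
      intro n
      induction n with
      | zero => simp [hcol x₀ hrx]
      | succ n ih =>
        rw [Finset.sum_range_succ, Finset.sum_range_succ]
        have := hcl (x₀ + n) y
        push_cast
        rw [show x₀ + ((n : ZMod N) + 1) = x₀ + n + 1 by ring]
        linear_combination ih + this - v (x₀ + n + 1, y) * two
    rw [key, ZMod.natCast_zmod_val, add_sub_cancel]
  refine ⟨g, hgX, hgY, g (0, y₀), ?_⟩
  have hbase : ∀ x, g (x, y₀) = g (0, y₀) := by
    intro x
    refine eq_of_add_one_eq (fun x => g (x, y₀)) (fun x => ?_) x 0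
    have := hgX (x, y₀)
    rw [hrow, zmod_two_eq_iff] at this
    simpa using this
  have hcolconst : ∀ x, x ∉ D.image Prod.fst → ∀ y, g (x, y) = g (0, y₀) := by
    intro x hx y
    rw [← hbase x]
    refine eq_of_add_one_eq (fun y => g (x, y)) (fun y => ?_) y y₀
    have := hgY (x, y)
    rw [hcol x hx, zmod_two_eq_iff] at this
    simpa using this
  rintro ⟨x, y⟩ hs
  -- Walking right from the site reaches a column free of `D` within `D.card` steps, without
  -- crossing a bond that touches `D`; on free columns `g` has its base value.
  obtain ⟨r, hr, hrD⟩ := exists_missed_shift _ hcols x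
  have hwalk : ∀ n : ℕ, n ≤ r → g (x, y) = g (x + n, y) := by
    intro n
    induction n with
    | zero => simp
    | succ n ih =>
      intro hn
      rw [ih (by omega)]
      have h0 : h (x + n, y) = 0 := by
        by_contra hne
        have hr' := hr.trans Finset.card_image_le
        rcases hh _ hne with hm | hm
        · exact hs n (by omega) (by simpa using hm)
        · refine hs (n + 1) (by omega) ?_
          simpa [add_assoc] using hm
      have := hgX (x + n, y)
      rw [h0, zmod_two_eq_iff] at this
      simpa [add_assoc] using this
  rw [hwalk r le_rfl]
  exact hcolconst _ hrD y

end Potential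

/-! ### Separating clusters -/

section Separation
variable {N : ℕ} [NeZero N]

open Classical in
/-- If `A` is a union of components of the complement of `Bad`, and `s ∈ A`, `t ∉ A`, then there
is a bad cluster that is large, or close to `s` or to `t`. -/
theorem exists_separating_cluster (Bad A : Set (ZMod N × ZMod N)) (hA : ∀ b ∈ A, b ∉ Bad)
    (hX : ∀ b, b ∉ Bad → b + (1, 0) ∉ Bad → (b ∈ A ↔ b + (1, 0) ∈ A))
    (hY : ∀ b, b ∉ Bad → b + (0, 1) ∉ Bad → (b ∈ A ↔ b + (0, 1) ∈ A))
    (s t : ZMod N × ZMod N) (hs : s ∈ A) (ht : t ∉ A) :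
    (∃ v ∈ Bad, N ≤ (cluster Bad v).ncard) ∨
      ∃ r : ℕ, r < N ∧
        ((s + ((r : ZMod N), 0) ∈ Bad ∧ r ≤ (cluster Bad (s + ((r : ZMod N), 0))).ncard) ∨
          (t + ((r : ZMod N), 0) ∈ Bad ∧ r ≤ (cluster Bad (t + ((r : ZMod N), 0))).ncard)) := by
  by_contra hcon
  push Not at hcon
  obtain ⟨hsmall, hnear⟩ := hcon
  have two : (2 : ZMod 2) = 0 := by decide
  let comp : ZMod N × ZMod N → (badGraph Bad).ConnectedComponent :=
    (badGraph Bad).connectedComponentMk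
  let f : ZMod N × ZMod N → ZMod 2 := fun b => if b ∈ A then 1 else 0
  -- A bond on the boundary of `A` has its end outside `A` in `Bad`; the bond is assigned to the
  -- cluster of that end.
  let out : ZMod N × ZMod N → ZMod N × ZMod N → ZMod N × ZMod N :=
    fun b c => if b ∈ A then c else b
  let edge : (badGraph Bad).ConnectedComponent → ZMod N × ZMod N → ZMod N × ZMod N → ZMod 2 :=
    fun C b c => if comp (out b c) = C then f b + f c else 0
  have hout : ∀ b c, (b ∉ Bad → c ∉ Bad → (b ∈ A ↔ c ∈ A)) → f b + f c ≠ 0 →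
      out b c ∈ Bad ∧ (out b c = b ∨ out b c = c) := by
    intro b c hbc hne
    have hdiff : ¬ (b ∈ A ↔ c ∈ A) := by
      intro hiff
      apply hne
      rw [zmod_two_eq_iff]
      simp only [f, hiff]
    simp only [out]
    by_cases hb : b ∈ A
    · rw [if_pos hb]
      refine ⟨?_, Or.inr rfl⟩
      by_contra hc
      exact hdiff (hbc (hA b hb) hc)
    · rw [if_neg hb]
      refine ⟨?_, Or.inl rfl⟩
      by_contra hb'
      have hc : c ∈ A := by tauto
      exact hdiff (hbc hb' (hA c hc))
  have hcomp : ∀ b c, b ∈ Bad → c ∈ Bad → c - b ∈ kingSteps N → comp b = comp c := by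
    intro b c hb hc hd
    by_cases hbc : b = c
    · rw [hbc]
    · exact SimpleGraph.ConnectedComponent.eq.2
        (SimpleGraph.Adj.reachable (G := badGraph Bad) ⟨hbc, hd, hb, hc⟩)
  let hE := fun (C : (badGraph Bad).ConnectedComponent) b => edge C b (b + (1, 0))
  let vE := fun (C : (badGraph Bad).ConnectedComponent) b => edge C b (b + (0, 1))
  have hclosed : ∀ C b, hE C b + vE C (b + (1, 0)) + hE C (b + (0, 1)) + vE C b = 0 := by
    intro C b
    have e3 : b + (0, 1) + (1, 0) = b + (1, 0) + (0, 1) := by abel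
    have hplaq : ∀ x y, (x = b ∨ x = b + (1, 0) ∨ x = b + (0, 1) ∨ x = b + (1, 0) + (0, 1)) →
        (y = b ∨ y = b + (1, 0) ∨ y = b + (0, 1) ∨ y = b + (1, 0) + (0, 1)) →
        y - x ∈ kingSteps N := by
      have hval : ∀ x, (x = b ∨ x = b + (1, 0) ∨ x = b + (0, 1) ∨ x = b + (1, 0) + (0, 1)) →
          (x.1 = b.1 ∨ x.1 = b.1 + 1) ∧ (x.2 = b.2 ∨ x.2 = b.2 + 1) := by
        rintro x (rfl | rfl | rfl | rfl) <;> simp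
      intro x y hx hy
      obtain ⟨hx1, hx2⟩ := hval x hx
      obtain ⟨hy1, hy2⟩ := hval y hy
      simp only [kingSteps, Finset.mem_product, Finset.mem_insert, Finset.mem_singleton,
        Prod.fst_sub, Prod.snd_sub]
      refine ⟨?_, ?_⟩
      · rcases hx1 with h | h <;> rcases hy1 with h' | h' <;> rw [h, h'] <;> simp
      · rcases hx2 with h | h <;> rcases hy2 with h' | h' <;> rw [h, h'] <;> simp
    -- The corners of a plaquette are king neighbours, so all boundary bonds around it belong to one
    -- cluster. Each cluster's share of the boundary is therefore closed by itself.
    obtain ⟨q, hq⟩ : ∃ q, ∀ x y,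
        (x = b ∨ x = b + (1, 0) ∨ x = b + (0, 1) ∨ x = b + (1, 0) + (0, 1)) →
        (y = b ∨ y = b + (1, 0) ∨ y = b + (0, 1) ∨ y = b + (1, 0) + (0, 1)) →
        (y = x + (1, 0) ∨ y = x + (0, 1)) → f x + f y ≠ 0 → comp (out x y) = q := by
      by_cases hex : ∃ o ∈ Bad, o = b ∨ o = b + (1, 0) ∨ o = b + (0, 1) ∨ o = b + (1, 0) + (0, 1)
      · obtain ⟨o, ho, ho'⟩ := hex
        refine ⟨comp o, fun x y hx hy hxy hne => ?_⟩
        obtain ⟨h1, h2⟩ := hout x y (by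
          rcases hxy with rfl | rfl
          · exact hX x
          · exact hY x) hne
        refine hcomp _ _ h1 ho (hplaq _ _ ?_ ho')
        rcases h2 with h2 | h2 <;> rw [h2] <;> assumption
      · refine ⟨comp b, fun x y hx hy hxy hne => ?_⟩
        obtain ⟨h1, h2⟩ := hout x y (by
          rcases hxy with rfl | rfl
          · exact hX x
          · exact hY x) hne
        exact absurd ⟨_, h1, by rcases h2 with h2 | h2 <;> rw [h2] <;> assumption⟩ hex
    have hval : ∀ x y,
        (x = b ∨ x = b + (1, 0) ∨ x = b + (0, 1) ∨ x = b + (1, 0) + (0, 1)) →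
        (y = b ∨ y = b + (1, 0) ∨ y = b + (0, 1) ∨ y = b + (1, 0) + (0, 1)) →
        (y = x + (1, 0) ∨ y = x + (0, 1)) →
        edge C x y = if q = C then f x + f y else 0 := by
      intro x y hx hy hxy
      simp only [edge]
      by_cases hne : f x + f y = 0
      · rw [hne, ite_self, ite_self]
      · rw [hq x y hx hy hxy hne]
    simp only [hE, vE]
    rw [hval b (b + (1, 0)) (by simp) (by simp) (by simp),
      hval (b + (1, 0)) (b + (1, 0) + (0, 1)) (by simp) (by simp) (by simp),
      hval (b + (0, 1)) (b + (0, 1) + (1, 0)) (by simp) (by rw [e3]; simp) (by simp),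
      hval b (b + (0, 1)) (by simp) (by simp) (by simp), e3]
    split_ifs
    · linear_combination (f b + f (b + (1, 0)) + f (b + (0, 1)) + f (b + (1, 0) + (0, 1))) * two
    · simp
  let D : (badGraph Bad).ConnectedComponent → Finset (ZMod N × ZMod N) :=
    fun C => Finset.univ.filter fun b => b ∈ Bad ∧ comp b = C
  have hDle : ∀ C, ∀ b ∈ D C, (D C).card ≤ (cluster Bad b).ncard := by
    intro C b hb
    simp only [D, Finset.mem_filter, Finset.mem_univ, true_and] at hb
    rw [← Set.ncard_coe_finset]
    refine Set.ncard_le_ncard ?_ (Set.toFinite _)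
    intro c hc
    simp only [D, Finset.coe_filter, Finset.mem_univ, true_and, Set.mem_ofPred_eq] at hc
    exact SimpleGraph.ConnectedComponent.eq.1 (hb.2.trans hc.2.symm)
  have hDmem : ∀ C, ∀ b ∈ D C, b ∈ Bad := by
    intro C b hb
    exact (Finset.mem_filter.1 hb).2.1
  have hDN : ∀ C, (D C).card < N := by
    intro C
    rcases (D C).eq_empty_or_nonempty with h0 | ⟨b, hb⟩
    · rw [h0]
      exact NeZero.pos N
    · exact (hDle C b hb).trans_lt (hsmall b (hDmem C b hb))
  have hedgeD : ∀ C b c, (b ∉ Bad → c ∉ Bad → (b ∈ A ↔ c ∈ A)) → edge C b c ≠ 0 →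
      b ∈ D C ∨ c ∈ D C := by
    intro C b c hbc hne
    simp only [edge] at hne
    split_ifs at hne with hC
    · obtain ⟨h1, h2⟩ := hout b c hbc hne
      have : out b c ∈ D C := by simp [D, h1, hC]
      rcases h2 with h2 | h2
      · left; rwa [h2] at this
      · right; rwa [h2] at this
    · exact absurd rfl hne
  -- As no cluster is large, each share is a coboundary; as none is near `s` or `t`, its potential
  -- takes the same value at both.
  have hpot := fun C => exists_potential (hE C) (vE C) (hclosed C) (D C) (hDN C)
    (fun b => hedgeD C b _ (hX b)) (fun b => hedgeD C b _ (hY b))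
  choose g hgX hgY g₀ hg₀ using hpot
  have hgs : ∀ C, g C s = g₀ C := by
    intro C
    refine hg₀ C s fun r hr hrD => ?_
    have := (hnear r (hr.trans_lt (hDN C))).1 (hDmem C _ hrD)
    have := hDle C _ hrD
    omega
  have hgt : ∀ C, g C t = g₀ C := by
    intro C
    refine hg₀ C t fun r hr hrD => ?_
    have := (hnear r (hr.trans_lt (hDN C))).2 (hDmem C _ hrD)
    have := hDle C _ hrD
    omega
  have hedgesum : ∀ b c, ∑ C, edge C b c = f b + f c := by
    intro b c
    simp only [edge]
    rw [Finset.sum_ite_eq]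
    simp
  -- The potentials sum to the indicator of `A` up to a constant, so the indicator would agree at
  -- `s` and `t`.
  let F : ZMod N × ZMod N → ZMod 2 := fun b => ∑ C, g C b + f b
  have hFX : ∀ b, F b = F (b + (1, 0)) := by
    intro b
    rw [← zmod_two_eq_iff]
    have h1 : ∑ C, (g C b + g C (b + (1, 0))) = f b + f (b + (1, 0)) := by
      rw [← hedgesum]
      exact Finset.sum_congr rfl fun C _ => hgX C b
    rw [Finset.sum_add_distrib] at h1
    simp only [F]
    linear_combination h1 + (f b + f (b + (1, 0))) * two
  have hFY : ∀ b, F b = F (b + (0, 1)) := by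
    intro b
    rw [← zmod_two_eq_iff]
    have h1 : ∑ C, (g C b + g C (b + (0, 1))) = f b + f (b + (0, 1)) := by
      rw [← hedgesum]
      exact Finset.sum_congr rfl fun C _ => hgY C b
    rw [Finset.sum_add_distrib] at h1
    simp only [F]
    linear_combination h1 + (f b + f (b + (0, 1))) * two
  have hFst : F s = F t := by
    obtain ⟨s1, s2⟩ := s
    obtain ⟨t1, t2⟩ := t
    exact (eq_of_add_one_eq (fun x => F (x, s2)) (fun x => by simpa using hFX (x, s2)) s1 t1).trans
      (eq_of_add_one_eq (fun y => F (t1, y)) (fun y => by simpa using hFY (t1, y)) s2 t2)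
  simp only [F, hgs, hgt, f, if_pos hs, if_neg ht] at hFst
  exact absurd (add_left_cancel hFst) (by decide)

end Separation

/-! ### The contour estimate -/

theorem sq_le_two_pow_succ (n : ℕ) : n ^ 2 ≤ 2 ^ (n + 1) := by
  rcases Nat.lt_or_ge n 3 with h | h
  · interval_cases n <;> norm_num
  · induction n, h using Nat.le_induction with
    | base => norm_num
    | succ n hn ih =>
      rw [pow_succ 2 (n + 1)]
      nlinarith

/-- The exponent `r - 1 + 1` is `max r 1`: a cluster has at least one vertex even at distance 0. -/
theorem sum_pow_pred_le (q : ℝ) (hq : 0 ≤ q) (hq2 : q ≤ 1 / 2) (n : ℕ) :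
    ∑ r ∈ Finset.range n, q ^ (r - 1 + 1) ≤ 4 * q := by
  have h1 : ∀ r ∈ Finset.range n, q ^ (r - 1 + 1) ≤ 2 * q * (1 / 2) ^ r := by
    intro r _
    rcases r with _ | r
    · simp
      linarith
    · rw [Nat.add_sub_cancel, pow_succ, pow_succ]
      have := pow_le_pow_left₀ hq hq2 r
      nlinarith
  refine (Finset.sum_le_sum h1).trans ?_
  rw [← Finset.mul_sum]
  have h2 : ∑ r ∈ Finset.range n, ((1 : ℝ) / 2) ^ r ≤ 2 := sum_geometric_two_le n
  nlinarith

theorem sq_mul_pow_le (q : ℝ) (hq : 0 ≤ q) (hq2 : q ≤ 1 / 2) (n : ℕ) :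
    ((n + 1 : ℕ) : ℝ) ^ 2 * q ^ (n + 1) ≤ 4 * q := by
  have h1 : ((n + 1 : ℕ) : ℝ) ^ 2 ≤ 2 ^ (n + 2) := by exact_mod_cast sq_le_two_pow_succ (n + 1)
  calc ((n + 1 : ℕ) : ℝ) ^ 2 * q ^ (n + 1) ≤ 2 ^ (n + 2) * ((1 / 2) ^ n * q) := by
        rw [pow_succ q]
        exact mul_le_mul h1 (mul_le_mul_of_nonneg_right (pow_le_pow_left₀ hq hq2 n) hq)
          (by positivity) (by positivity)
    _ = 4 * q * (2 * (1 / 2)) ^ n := by rw [mul_pow]; ring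
    _ = 4 * q := by norm_num

/-- Three contributions of at most `4 * q` each, with `q = 81 * ε`: large clusters at any of the `N
^ 2` positions, clusters near `s`, and clusters near `t`. -/
theorem weightOf_separated_le {Ω : Type*} [Fintype Ω] {w : Ω → ℝ} {N : ℕ} [NeZero N]
    (hw : ∀ ω, 0 ≤ w ω) (Bad A : Ω → Set (ZMod N × ZMod N)) (ε Z : ℝ) (hε : 0 ≤ ε)
    (hε2 : 81 * ε ≤ 1 / 2) (hZ : 0 ≤ Z)
    (hB : ∀ B : Finset (ZMod N × ZMod N), weightOf w (fun ω => ∀ b ∈ B, b ∈ Bad ω) ≤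
      ε ^ B.card * Z)
    (hA : ∀ ω, ∀ b ∈ A ω, b ∉ Bad ω)
    (hX : ∀ ω b, b ∉ Bad ω → b + (1, 0) ∉ Bad ω → (b ∈ A ω ↔ b + (1, 0) ∈ A ω))
    (hY : ∀ ω b, b ∉ Bad ω → b + (0, 1) ∉ Bad ω → (b ∈ A ω ↔ b + (0, 1) ∈ A ω))
    (s t : ZMod N × ZMod N) :
    weightOf w (fun ω => s ∈ A ω ∧ t ∉ A ω) ≤ 12 * (81 * ε) * Z := by
  classical
  set q := 81 * ε with hq
  have hq0 : 0 ≤ q := by positivity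
  let L : ZMod N × ZMod N → ℕ → Ω → Prop :=
    fun v m ω => v ∈ Bad ω ∧ m + 1 ≤ (cluster (Bad ω) v).ncard
  have hL : ∀ v m, weightOf w (L v m) ≤ q ^ (m + 1) * Z :=
    fun v m => weightOf_cluster_le hw Bad ε Z hε hZ hB v m
  have hself : ∀ ω v, 1 ≤ (cluster (Bad ω) v).ncard := fun ω v =>
    (Set.ncard_pos (Set.toFinite _)).2 ⟨v, SimpleGraph.Reachable.refl v⟩
  have hN : N - 1 + 1 = N := Nat.sub_add_cancel (NeZero.pos N)
  have hsub : ∀ ω, (s ∈ A ω ∧ t ∉ A ω) →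
      (∃ v ∈ (Finset.univ : Finset (ZMod N × ZMod N)), L v (N - 1) ω) ∨
      ((∃ r ∈ Finset.range N, L (s + ((r : ZMod N), 0)) (r - 1) ω) ∨
        ∃ r ∈ Finset.range N, L (t + ((r : ZMod N), 0)) (r - 1) ω) := by
    rintro ω ⟨hs, ht⟩
    have hnear : ∀ (v : ZMod N × ZMod N) (r : ℕ), v ∈ Bad ω →
        r ≤ (cluster (Bad ω) v).ncard → L v (r - 1) ω := by
      intro v r hv hr
      have := hself ω v
      exact ⟨hv, by omega⟩
    rcases exists_separating_cluster (Bad ω) (A ω) (hA ω) (hX ω) (hY ω) s t hs ht with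
      ⟨v, hv, hvN⟩ | ⟨r, hrN, ⟨hr, hr'⟩ | ⟨hr, hr'⟩⟩
    · exact Or.inl ⟨v, Finset.mem_univ v, hnear v N hv hvN⟩
    · exact Or.inr (Or.inl ⟨r, Finset.mem_range.2 hrN, hnear _ r hr hr'⟩)
    · exact Or.inr (Or.inr ⟨r, Finset.mem_range.2 hrN, hnear _ r hr hr'⟩)
  have hline : ∀ v : ZMod N × ZMod N,
      weightOf w (fun ω => ∃ r ∈ Finset.range N, L (v + ((r : ZMod N), 0)) (r - 1) ω) ≤
        4 * q * Z := by
    intro v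
    refine (weightOf_exists_le hw _ _).trans ((Finset.sum_le_sum fun r _ => hL _ _).trans ?_)
    rw [← Finset.sum_mul]
    exact mul_le_mul_of_nonneg_right (sum_pow_pred_le q hq0 hε2 N) hZ
  have hbig : weightOf w
      (fun ω => ∃ v ∈ (Finset.univ : Finset (ZMod N × ZMod N)), L v (N - 1) ω) ≤ 4 * q * Z := by
    refine (weightOf_exists_le hw _ _).trans ((Finset.sum_le_sum fun v _ => hL v (N - 1)).trans ?_)
    rw [Finset.sum_const, Finset.card_univ, Fintype.card_prod, ZMod.card, nsmul_eq_mul, ← mul_assoc]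
    refine mul_le_mul_of_nonneg_right ?_ hZ
    have := sq_mul_pow_le q hq0 hε2 (N - 1)
    rw [hN] at this ⊢
    rwa [Nat.cast_mul, ← sq]
  refine (weightOf_mono hw hsub).trans ((weightOf_or_le hw _ _).trans ?_)
  have := weightOf_or_le hw
    (fun ω => ∃ r ∈ Finset.range N, L (s + ((r : ZMod N), 0)) (r - 1) ω)
    (fun ω => ∃ r ∈ Finset.range N, L (t + ((r : ZMod N), 0)) (r - 1) ω)
  have := hline s
  have := hline t
  linarith

/-! ### Opposite spins in the decorated model -/

section
variable {N L₁ L₂ : ℕ} [NeZero N] [NeZero L₁] [NeZero L₂]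

/-- The weight of a configuration of the decorated model. -/
def decoMass (κ h β : ℝ) (η : Deco N L₁ L₂ → ℤˣ) : ℝ :=
  Real.exp (isingExponent halfSrc halfTgt κ (decoField h β) η)

theorem weightOf_decoMass_mixed (κ h β : ℝ) (B : Set (ZMod N × ZMod N)) :
    weightOf (decoMass (L₁ := L₁) (L₂ := L₂) κ h β) (fun η => ∀ b ∈ B, Mixed (block b) η) =
      decoWeight (L₁ := L₁) (L₂ := L₂) κ h β B := rfl

theorem weightOf_opposite_le (hN : Even N) (J κ h β : ℝ) (hh : 0 < h) (hβ : 0 < β)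
    (hκ : β * J ≤ κ) (hP : 0 < peierlsConst L₁ L₂ J h)
    (hx : 4 * ((L₁ : ℝ) * L₂) * Real.exp (-(β / 2) * peierlsConst L₁ L₂ J h) ≤ 1)
    (hy : 81 * (6 * Real.exp (-(β / 8) * peierlsConst L₁ L₂ J h)) ≤ 1 / 2)
    (s t : Torus N L₁ L₂) :
    weightOf (decoMass κ h β) (fun η => η (.inl s) = 1 ∧ η (.inl t) = -1) ≤
      6000 * Real.exp (-(β / 8) * peierlsConst L₁ L₂ J h) *
        decoWeight (N := N) (L₁ := L₁) (L₂ := L₂) κ h β ∅ := by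
  set y := Real.exp (-(β / 8) * peierlsConst L₁ L₂ J h) with hydef
  set Z := decoWeight (N := N) (L₁ := L₁) (L₂ := L₂) κ h β ∅ with hZdef
  have hy0 : 0 < y := Real.exp_pos _
  have hZ : 0 < Z := (Real.exp_pos _).trans_le (le_decoWeight_empty hN κ h β)
  have hw : ∀ η : Deco N L₁ L₂ → ℤˣ, 0 ≤ decoMass κ h β η := fun η => (Real.exp_pos _).le
  -- Bad blocks are the mixed ones, and `A` collects the blocks that are constantly `+1`. Either the
  -- block chosen at `s` is bad, or it lies in `A` while the one at `t` does not.
  let Bad : (Deco N L₁ L₂ → ℤˣ) → Set (ZMod N × ZMod N) := fun η => {b | Mixed (block b) η}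
  let A : (Deco N L₁ L₂ → ℤˣ) → Set (ZMod N × ZMod N) :=
    fun η => {b | ¬ Mixed (block b) η ∧ ∀ p ∈ block b, η p = 1}
  have hB : ∀ B : Finset (ZMod N × ZMod N),
      weightOf (decoMass (L₁ := L₁) (L₂ := L₂) κ h β) (fun η => ∀ b ∈ B, b ∈ Bad η) ≤
        (6 * y) ^ B.card * Z := fun B =>
    decoWeight_le_pow hN κ h β (6 * y) (by positivity)
      (decoWeight_univ_le hN J κ h β hh hβ hκ hP hx) hZ B
  have hshare : ∀ (η : Deco N L₁ L₂ → ℤˣ) (b c : ZMod N × ZMod N),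
      (∃ p : Deco N L₁ L₂, p ∈ block b ∧ p ∈ block c) → b ∉ Bad η → c ∉ Bad η →
      b ∈ A η → c ∈ A η := by
    rintro η b c ⟨p, hpb, hpc⟩ _ hc hbA
    refine ⟨hc, fun r hr => ?_⟩
    by_contra hne
    exact hc ⟨r, hr, p, hpc, fun e => hne (e.trans (hbA.2 p hpb))⟩
  have hmain := fun b c => weightOf_separated_le hw Bad A (6 * y) Z (by positivity) hy hZ.le hB
    (fun η b hb => hb.1)
    (fun η b h1 h2 => by
      obtain ⟨p, hp, hp'⟩ := block_inter_X (L₁ := L₁) (L₂ := L₂) b.1 b.2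
      have hp'' : p ∈ block (b + (1, 0)) := by
        rwa [show b + (1, 0) = (b.1 + 1, b.2) by ext <;> simp]
      exact ⟨hshare η _ _ ⟨p, hp, hp''⟩ h1 h2, hshare η _ _ ⟨p, hp'', hp⟩ h2 h1⟩)
    (fun η b h1 h2 => by
      obtain ⟨p, hp, hp'⟩ := block_inter_Y (L₁ := L₁) (L₂ := L₂) b.1 b.2
      have hp'' : p ∈ block (b + (0, 1)) := by
        rwa [show b + (0, 1) = (b.1, b.2 + 1) by ext <;> simp]
      exact ⟨hshare η _ _ ⟨p, hp, hp''⟩ h1 h2, hshare η _ _ ⟨p, hp'', hp⟩ h2 h1⟩) b c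
  obtain ⟨b, hb⟩ := exists_block (.inl s : Deco N L₁ L₂)
  obtain ⟨c, hc⟩ := exists_block (.inl t : Deco N L₁ L₂)
  have hsub : ∀ η : Deco N L₁ L₂ → ℤˣ, (η (.inl s) = 1 ∧ η (.inl t) = -1) →
      (∀ b' ∈ ({b} : Finset (ZMod N × ZMod N)), b' ∈ Bad η) ∨ (b ∈ A η ∧ c ∉ A η) := by
    rintro η ⟨h1, h2⟩
    by_cases hbad : b ∈ Bad η
    · left
      intro b' hb'
      rwa [Finset.mem_singleton.1 hb']
    · right
      refine ⟨⟨hbad, fun p hp => ?_⟩, fun hcA => ?_⟩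
      · by_contra hne
        exact hbad ⟨p, hp, _, hb, fun e => hne (e.trans h1)⟩
      · have := hcA.2 _ hc
        rw [h2] at this
        exact absurd this (by decide)
  refine (weightOf_mono hw hsub).trans ((weightOf_or_le hw _ _).trans ?_)
  have h1 := hB {b}
  have h2 := hmain b c
  rw [Finset.card_singleton, pow_one] at h1
  have h3 : 0 < y * Z := mul_pos hy0 hZ
  -- The two cases contribute `6` and `12 * 81 * 6`, in all `5838 ≤ 6000`.
  nlinarith

/-! ### Summing out the decorations -/

/-- Intermediate values on `[a, a + log 2]`. The bound `a ≤ κ` keeps the half-bond cost at least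
that of an original bond. -/
theorem exists_decoration_coupling (a : ℝ) (ha : 0 ≤ a) :
    ∃ κ, a ≤ κ ∧ Real.cosh (2 * κ) = Real.exp (2 * a) := by
  have h1 : Real.cosh (2 * a) ≤ Real.exp (2 * a) := by
    rw [Real.cosh_eq]
    have : Real.exp (-(2 * a)) ≤ Real.exp (2 * a) := Real.exp_le_exp.2 (by linarith)
    linarith
  have h2 : Real.exp (2 * a) ≤ Real.cosh (2 * (a + Real.log 2)) := by
    rw [Real.cosh_eq, show 2 * (a + Real.log 2) = 2 * a + (Real.log 2 + Real.log 2) by ring,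
      Real.exp_add, Real.exp_add, Real.exp_log two_pos]
    have := Real.exp_pos (2 * a)
    have := Real.exp_pos (-(2 * a + (Real.log 2 + Real.log 2)))
    linarith
  have hab : a ≤ a + Real.log 2 := by linarith [Real.log_pos one_lt_two]
  obtain ⟨κ, hκ, hκ'⟩ := intermediate_value_Icc hab
    (f := fun x => Real.cosh (2 * x)) (by fun_prop) ⟨h1, h2⟩
  exact ⟨κ, hκ.1, hκ'⟩

/-- Equal ends give `2 * cosh (2 * κ) = 2 * exp (2 * a)`, opposite ends give `2`: an Ising bond of
strength `a` up to the factor `2 * exp a`. -/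
theorem sum_decoration (a κ : ℝ) (hκ : Real.cosh (2 * κ) = Real.exp (2 * a)) (u v : ℤˣ) :
    ∑ x : ℤˣ, Real.exp (κ * ((x : ℤ) : ℝ) * (((u : ℤ) : ℝ) + ((v : ℤ) : ℝ))) =
      2 * Real.exp a * Real.exp (a * (((u : ℤ) : ℝ) * ((v : ℤ) : ℝ))) := by
  rw [Real.cosh_eq] at hκ
  have hsum : ∀ g : ℤˣ → ℝ, ∑ x : ℤˣ, g x = g 1 + g (-1) := fun g => by
    rw [show (Finset.univ : Finset ℤˣ) = {1, -1} from rfl, Finset.sum_pair (by decide)]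
  have e2 : Real.exp a * Real.exp a = Real.exp (2 * a) := by rw [← Real.exp_add]; ring_nf
  have e0 : Real.exp a * Real.exp (-a) = 1 := by rw [← Real.exp_add]; simp
  rw [hsum]
  rcases Int.units_eq_one_or u with rfl | rfl <;> rcases Int.units_eq_one_or v with rfl | rfl <;>
    simp <;> norm_num
  · rw [mul_assoc, e2, ← hκ]; ring_nf
  · rw [mul_assoc, e0]; norm_num
  · rw [mul_assoc, e0]; norm_num
  · rw [mul_assoc, e2, ← hκ]; ring_nf

theorem isingExponent_elim (κ h β : ℝ) (σ : Config N L₁ L₂)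
    (τ : Torus N L₁ L₂ ⊕ Torus N L₁ L₂ → ℤˣ) :
    isingExponent halfSrc halfTgt κ (decoField h β) (Sum.elim σ τ) =
      ∑ e, κ * ((τ e : ℤ) : ℝ) * (Sum.elim (fun t => spin σ t + spin σ (t + (1, 0)))
        (fun t => spin σ t + spin σ (t + (0, 1))) e) +
      β * ∑ t, torusField N L₁ L₂ h t * spin σ t := by
  rw [isingExponent]
  congr 1
  · rw [Fintype.sum_sum_type, Fintype.sum_prod_type, Finset.mul_sum, ← Finset.sum_add_distrib]
    refine Finset.sum_congr rfl fun t _ => ?_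
    rw [Fintype.sum_prod_type]
    simp only [Fintype.sum_bool, halfSrc, halfTgt, Sum.elim_inl, Sum.elim_inr, spin]
    ring
  · rw [Fintype.sum_sum_type, Finset.mul_sum]
    simp only [decoField, zero_mul, Finset.sum_const_zero, add_zero, Sum.elim_inl, spin]
    exact Finset.sum_congr rfl fun t _ => by ring

theorem sum_decorations (J κ h β : ℝ) (hκ : Real.cosh (2 * κ) = Real.exp (2 * (β * J)))
    (σ : Config N L₁ L₂) :
    ∑ τ : Torus N L₁ L₂ ⊕ Torus N L₁ L₂ → ℤˣ, decoMass κ h β (Sum.elim σ τ) =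
      (2 * Real.exp (β * J)) ^ Fintype.card (Torus N L₁ L₂ ⊕ Torus N L₁ L₂) *
        Real.exp (-β * hamiltonian N L₁ L₂ J h σ) := by
  simp only [decoMass, isingExponent_elim, Real.exp_add, Real.exp_sum]
  rw [← Finset.sum_mul]
  have h1 := Finset.prod_univ_sum (fun _ : Torus N L₁ L₂ ⊕ Torus N L₁ L₂ => (Finset.univ : Finset ℤˣ))
    (fun e x => Real.exp (κ * ((x : ℤ) : ℝ) * (Sum.elim (fun t => spin σ t + spin σ (t + (1, 0)))
        (fun t => spin σ t + spin σ (t + (0, 1))) e)))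
  rw [Fintype.piFinset_univ] at h1
  rw [← h1, Fintype.prod_sum_type]
  simp only [Sum.elim_inl, Sum.elim_inr, spin, sum_decoration (β * J) κ hκ]
  simp only [Finset.prod_mul_distrib, ← Real.exp_sum, Finset.prod_const, Finset.card_univ]
  rw [Fintype.card_sum, pow_add, mul_mul_mul_comm, mul_assoc, ← Real.exp_add, ← Real.exp_add]
  congr 1
  · simp only [mul_pow]
  · congr 1
    simp only [hamiltonian, spin, Finset.sum_add_distrib, ← Finset.mul_sum]
    ring

theorem weightOf_decoMass (J κ h β : ℝ) (hκ : Real.cosh (2 * κ) = Real.exp (2 * (β * J)))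
    (E : Config N L₁ L₂ → Prop) :
    weightOf (decoMass κ h β) (fun η => E fun t => η (.inl t)) =
      (2 * Real.exp (β * J)) ^ Fintype.card (Torus N L₁ L₂ ⊕ Torus N L₁ L₂) *
        weightOf (fun σ => Real.exp (-β * hamiltonian N L₁ L₂ J h σ)) E := by
  classical
  unfold weightOf
  rw [← (Equiv.sumArrowEquivProdArrow (Torus N L₁ L₂) (Torus N L₁ L₂ ⊕ Torus N L₁ L₂)
    ℤˣ).symm.sum_comp, Fintype.sum_prod_type, Finset.mul_sum]
  refine Finset.sum_congr rfl fun σ _ => ?_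
  have e : ∀ τ, (Equiv.sumArrowEquivProdArrow (Torus N L₁ L₂) (Torus N L₁ L₂ ⊕ Torus N L₁ L₂)
    ℤˣ).symm (σ, τ) = Sum.elim σ τ := fun τ => rfl
  simp only [e, Sum.elim_inl]
  by_cases hE : E σ
  · simp only [hE, if_true]
    exact sum_decorations J κ h β hκ σ
  · simp [hE]

theorem gibbsProb_eq (J κ h β : ℝ) (hκ : Real.cosh (2 * κ) = Real.exp (2 * (β * J)))
    (E : Config N L₁ L₂ → Prop) :
    gibbsProb N L₁ L₂ J h β {σ | E σ} =
      weightOf (decoMass κ h β) (fun η => E fun t => η (.inl t)) /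
        decoWeight (N := N) (L₁ := L₁) (L₂ := L₂) κ h β ∅ := by
  classical
  have hZ : decoWeight (N := N) (L₁ := L₁) (L₂ := L₂) κ h β ∅ =
      (2 * Real.exp (β * J)) ^ Fintype.card (Torus N L₁ L₂ ⊕ Torus N L₁ L₂) *
        partitionFunction N L₁ L₂ J h β := by
    have h1 := weightOf_decoMass (N := N) (L₁ := L₁) (L₂ := L₂) J κ h β hκ (fun _ => True)
    rw [← weightOf_decoMass_mixed]
    simp only [Set.mem_empty_iff_false, false_imp_iff, implies_true]
    rw [h1]
    simp [weightOf, partitionFunction]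
  rw [hZ, weightOf_decoMass J κ h β hκ, mul_div_mul_left _ _ (by positivity)]
  unfold gibbsProb gibbsMass weightOf
  rw [Finset.sum_div]
  refine Finset.sum_congr rfl fun σ _ => ?_
  by_cases hE : E σ
  · rw [Set.indicator_of_mem (show σ ∈ {σ | E σ} from hE), if_pos hE]
  · rw [Set.indicator_of_notMem (show σ ∉ {σ | E σ} from hE), if_neg hE, zero_div]

end

/-! ### The temperature threshold and the conclusion -/

theorem peierlsConst_pos (L₁ L₂ : ℕ) [NeZero L₁] [NeZero L₂] (J h : ℝ)
    (hJ : h < 2 * J / L₁ + 2 * J / L₂) : 0 < peierlsConst L₁ L₂ J h := by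
  have h1 : (0 : ℝ) < L₁ := by exact_mod_cast NeZero.pos L₁
  have h2 : (0 : ℝ) < L₂ := by exact_mod_cast NeZero.pos L₂
  rw [peierlsConst, sub_pos, div_lt_iff₀ (by positivity)]
  rw [div_add_div _ _ h1.ne' h2.ne', lt_div_iff₀ (by positivity)] at hJ
  linarith

theorem le_blockSide (L : ℕ) : L ≤ blockSide L := by
  unfold blockSide
  split_ifs <;> omega

/-- The smallness conditions that follow from the threshold with `c = 100`. -/
theorem smallness_of_threshold (L₁ L₂ : ℕ) (J h β : ℝ) (hP : 0 < peierlsConst L₁ L₂ J h)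
    (hβ : betaThreshold L₁ L₂ J h 100 < β) :
    0 < β ∧ 4 * ((L₁ : ℝ) * L₂) * Real.exp (-(β / 2) * peierlsConst L₁ L₂ J h) ≤ 1 ∧
      81 * (6 * Real.exp (-(β / 8) * peierlsConst L₁ L₂ J h)) ≤ 1 / 2 := by
  rw [betaThreshold, div_lt_iff₀ hP] at hβ
  set P := peierlsConst L₁ L₂ J h
  set B : ℝ := (blockSide L₁ : ℝ) * blockSide L₂ with hB
  have hB0 : 0 ≤ B := by positivity
  have hlog2 : 0 < Real.log 2 := Real.log_pos one_lt_two
  have hlogc : Real.log 1000 ≤ Real.log (100 * (100 + 1)) :=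
    Real.log_le_log (by norm_num) (by norm_num)
  have hlog1000 : 0 < Real.log 1000 := Real.log_pos (by norm_num)
  have hBlog : 0 ≤ B * Real.log 2 := by positivity
  refine ⟨?_, ?_, ?_⟩
  · have : 0 < β * P := by linarith
    exact (mul_pos_iff_of_pos_right hP).1 this
  · have h1 : Real.exp (-(β / 2) * P) ≤ Real.exp (-((L₁ * L₂ + 2 : ℕ) * Real.log 2)) := by
      refine Real.exp_le_exp.2 ?_
      have h2 : ((L₁ * L₂ : ℕ) : ℝ) ≤ B := by
        rw [hB]
        exact_mod_cast Nat.mul_le_mul (le_blockSide L₁) (le_blockSide L₂)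
      have h3 := mul_le_mul_of_nonneg_right h2 hlog2.le
      push_cast at h3 ⊢
      linarith
    have h4 : Real.exp (-((L₁ * L₂ + 2 : ℕ) * Real.log 2)) = ((2 : ℝ) ^ (L₁ * L₂ + 2))⁻¹ := by
      rw [Real.exp_neg, Real.exp_nat_mul, Real.exp_log two_pos]
    have h5 : 4 * ((L₁ : ℝ) * L₂) ≤ 2 ^ (L₁ * L₂ + 2) := by
      have : L₁ * L₂ ≤ 2 ^ (L₁ * L₂) := Nat.lt_two_pow_self.le
      have : 4 * (L₁ * L₂) ≤ 2 ^ (L₁ * L₂ + 2) := by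
        rw [pow_add]
        omega
      exact_mod_cast this
    rw [h4] at h1
    calc _ ≤ (2 : ℝ) ^ (L₁ * L₂ + 2) * ((2 : ℝ) ^ (L₁ * L₂ + 2))⁻¹ :=
          mul_le_mul h5 h1 (Real.exp_pos _).le (by positivity)
      _ = 1 := mul_inv_cancel₀ (by positivity)
  -- The logarithmic term of the threshold makes the exponential at most `1 / 1000`, and `81 * 6 /
  -- 1000 < 1 / 2`.
  · have h1 : Real.exp (-(β / 8) * P) ≤ Real.exp (-Real.log 1000) :=
      Real.exp_le_exp.2 (by linarith)
    rw [Real.exp_neg, Real.exp_log (by norm_num)] at h1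
    norm_num at h1 ⊢
    linarith

end CellBoard

end

theorem proposition3 :
    ∃ c : ℝ, 1 < c ∧
      ∀ (L₁ L₂ : ℕ) [NeZero L₁] [NeZero L₂] (J h : ℝ), 0 < J → 0 < h →
        h < 2 * J / L₁ + 2 * J / L₂ →
        ∀ β : ℝ, CellBoard.betaThreshold L₁ L₂ J h c < β →
        ∀ (N : ℕ) [NeZero N], Even N →
        ∀ s t : CellBoard.Torus N L₁ L₂,
          CellBoard.gibbsProb N L₁ L₂ J h β {σ | σ s = 1 ∧ σ t = -1} ≤
            2 * c * (c + 1) *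
              (2 : ℝ) ^ ((CellBoard.blockSide L₁ : ℝ) * (CellBoard.blockSide L₂ : ℝ) / 2) *
              Real.exp (-(β / 8) * CellBoard.peierlsConst L₁ L₂ J h) := by
  -- With `c = 100` one has `c * (c + 1) ≥ 1000` for the smallness conditions and `2 * c * (c + 1) ≥
  -- 6000` for the final bound.
  refine ⟨100, by norm_num, ?_⟩
  intro L₁ L₂ _ _ J h hJ hh hcrit β hβ N _ hN s t
  have hP := CellBoard.peierlsConst_pos L₁ L₂ J h hcrit
  obtain ⟨hβ0, hx, hy⟩ := CellBoard.smallness_of_threshold L₁ L₂ J h β hP hβ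
  obtain ⟨κ, hκ, hcosh⟩ := CellBoard.exists_decoration_coupling (β * J) (mul_pos hβ0 hJ).le
  have hZ : 0 < CellBoard.decoWeight (N := N) (L₁ := L₁) (L₂ := L₂) κ h β ∅ :=
    (Real.exp_pos _).trans_le (CellBoard.le_decoWeight_empty hN κ h β)
  rw [CellBoard.gibbsProb_eq J κ h β hcosh (fun σ => σ s = 1 ∧ σ t = -1), div_le_iff₀ hZ]
  refine (CellBoard.weightOf_opposite_le hN J κ h β hh hβ0 hκ hP hx hy s t).trans ?_
  refine mul_le_mul_of_nonneg_right (mul_le_mul_of_nonneg_right ?_ (Real.exp_pos _).le) hZ.le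
  -- The factor `2 ^ (B₁ B₂ / 2)` is not needed: it is at least 1.
  have : (1 : ℝ) ≤
      (2 : ℝ) ^ ((CellBoard.blockSide L₁ : ℝ) * (CellBoard.blockSide L₂ : ℝ) / 2) :=
    Real.one_le_rpow one_le_two (by positivity)
  linarith
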